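/- Let $\Gamma$ be a compact simple regular $C^1$ curve contained in the open upper half-plane $\mathbb H_+$, and let $z\in\mathbb H_+\setminus\Gamma$; if $\Gamma$ is closed, assume moreover that $\Gamma$ does not enclose $z$, i.e. that $z$ lies in the unbounded component of $\mathbb C\setminus\Gamma$. Let $L^2(\Gamma)=L^2(\Gamma,|d\tau|)$ be the space of complex-valued functions that are square integrable with respect to arc length, and put $$(\mathcal K u)(\zeta)=\frac1{2\pi}\int_\Gamma\frac{i\,u(\tau)}{\zeta-\overline{\tau}}\,|d\tau|,\qquad p_z(\zeta)=\frac{i}{\zeta-\overline z}.$$ For $\varepsilon>0$ let $u_\varepsilon\in L^2(\Gamma)$ solve $\mathcal K u_\varepsilon+\varepsilon^2u_\varepsilon=p_z$ in $L^2(\Gamma)$, and extend $u_\varepsilon$ to $\mathbb H_+$ by $u_\varepsilon(\zeta)=\varepsilon^{-2}\bigl(p_z(\zeta)-(\mathcal K u_\varepsilon)(\zeta)\bigr)$. Let $H^2(\mathbb H_+)$ be the Hardy space of the analytic functions $f$ on $\mathbb H_+$ with $\sup_{y>0}\|f(\cdot+iy)\|_{L^2(\mathbb R)}<\infty$, with the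 norm $\|f\|_{H^2}=\|f\|_{L^2(\mathbb R)}$ of the boundary data $f(x)=\lim_{y\downarrow0}f(x+iy)$. Then the extension of $u_\varepsilon$ belongs to $H^2(\mathbb H_+)$ and has boundary data in $L^2(\mathbb R)$ for every $\varepsilon>0$, and as $\varepsilon\downarrow0$: (i) $\|u_\varepsilon\|_{L^2(\Gamma)}\to\infty$; (ii) $u_\varepsilon/\|u_\varepsilon\|_{L^2(\Gamma)}\rightharpoonup0$ weakly in $L^2(\Gamma)$; (iii) $u_\varepsilon/\|u_\varepsilon\|_{H^2}\rightharpoonup0$ weakly in $L^2(\mathbb R)$, where $u_\varepsilon$ on $\mathbb R$ denotes the boundary data; (iv) $\|u_\varepsilon\|_{L^2(\Gamma)}=o(\varepsilon^{-1})$. -/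

import Mathlib

open MeasureTheory Filter Topology Set Asymptotics
open scoped ComplexConjugate NNReal ENNReal

noncomputable section

/-- `γ`, restricted to `[0,1]`, is a regular `C¹` parametrization of a compact simple curve.
Only the two endpoints may coincide (in which case the curve is closed). -/
structure IsSimpleC1Curve (γ : ℝ → ℂ) : Prop where
  contDiffOn : ContDiffOn ℝ 1 γ (Icc 0 1)
  regular : ∀ t ∈ Icc (0 : ℝ) 1, derivWithin γ (Icc 0 1) t ≠ 0
  simple : ∀ s ∈ Icc (0 : ℝ) 1, ∀ t ∈ Icc (0 : ℝ) 1, s < t → γ s = γ t → s = 0 ∧ t = 1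

/-- The curve `Γ` as a set of points. -/
def curveTrace (γ : ℝ → ℂ) : Set ℂ := γ '' Icc 0 1

/-- The arc length measure `|dτ|` on `Γ`, as a measure on `ℂ`: the image under `γ` of
`|γ'(t)| dt` on `[0,1]`. -/
def arcLength (γ : ℝ → ℂ) : Measure ℂ :=
  ((volume.restrict (Icc (0 : ℝ) 1)).withDensity
    (fun t => ENNReal.ofReal ‖derivWithin γ (Icc 0 1) t‖)).map γ

/-- `(𝒦u)(ζ) = (1/2π) ∫_Γ i u(τ) / (ζ - conj τ) |dτ|`, for `ζ` off the conjugate of `Γ`. -/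
def curveK (γ : ℝ → ℂ) (u : ℂ → ℂ) (ζ : ℂ) : ℂ :=
  (1 / (2 * (Real.pi : ℂ))) * ∫ τ, Complex.I * u τ / (ζ - conj τ) ∂(arcLength γ)

/-- `p_z(ζ) = i / (ζ - conj z)`. -/
def pFun (z ζ : ℂ) : ℂ := Complex.I / (ζ - conj z)

/-- `u ∈ L²(Γ)` solves the integral equation `𝒦u + ε²u = p_z` in `L²(Γ)`. -/
def SolvesEq (γ : ℝ → ℂ) (z : ℂ) (ε : ℝ) (u : Lp ℂ 2 (arcLength γ)) : Prop :=
  ∀ᵐ ζ ∂(arcLength γ), curveK γ u ζ + (ε : ℂ) ^ 2 * u ζ = pFun z ζ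

/-- The extension of a solution off `Γ`, defined by the integral equation:
`u(ζ) = ε⁻² (p_z(ζ) - (𝒦u)(ζ))`. -/
def extendSol (γ : ℝ → ℂ) (z : ℂ) (ε : ℝ) (u : ℂ → ℂ) (ζ : ℂ) : ℂ :=
  (pFun z ζ - curveK γ u ζ) / (ε : ℂ) ^ 2

/-- The Hardy space `H²` of the upper half-plane. -/
def MemHardy2 (f : ℂ → ℂ) : Prop :=
  DifferentiableOn ℂ f {ζ : ℂ | 0 < ζ.im} ∧
    ∃ C : ℝ≥0, ∀ y : ℝ, 0 < y →
      eLpNorm (fun x : ℝ => f ((x : ℂ) + (y : ℂ) * Complex.I)) 2 volume ≤ (C : ℝ≥0∞)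

/-- Boundary data on `ℝ` of a function on the upper half-plane (limit along vertical lines). -/
def boundaryData (f : ℂ → ℂ) (x : ℝ) : ℂ :=
  limUnder (𝓝[>] (0 : ℝ)) (fun y : ℝ => f ((x : ℂ) + (y : ℂ) * Complex.I))

/-- `g` is the `L²(ℝ)` boundary data of `f`. -/
def HasBoundaryData (f : ℂ → ℂ) (g : ℝ → ℂ) : Prop :=
  MemLp g 2 volume ∧
    ∀ᵐ x : ℝ, Tendsto (fun y : ℝ => f ((x : ℂ) + (y : ℂ) * Complex.I)) (𝓝[>] 0) (𝓝 (g x))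

/-- `‖f‖_{H²}`, the `L²(ℝ)` norm of the boundary data of `f`. -/
def hardyNorm (f : ℂ → ℂ) : ℝ := (eLpNorm (boundaryData f) 2 volume).toReal

/-- Weak convergence `v i ⇀ w` in `L²(μ)` along the filter `l`, membership in `L²(μ)` included. -/
def WeakTendstoL2 {α ι : Type*} [MeasurableSpace α] (μ : Measure α) (v : ι → α → ℂ)
    (l : Filter ι) (w : α → ℂ) : Prop :=
  (∀ᶠ i in l, MemLp (v i) 2 μ) ∧ MemLp w 2 μ ∧
    ∀ g : α → ℂ, MemLp g 2 μ →
      Tendsto (fun i => ∫ x, v i x * conj (g x) ∂μ) l (𝓝 (∫ x, w x * conj (g x) ∂μ))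

end

/-! Let `A` send `u ∈ L²(Γ)` to the boundary values of `𝒦u` on `ℝ`. The Szegő kernel reproduces
itself, so `A* A = 𝒦` on `L²(Γ)` and `A* p = p_z` there, with `p` the restriction of `p_z` to `ℝ`.
The integral equation is therefore the Tikhonov normal equation `A* A u + ε² u = A* p`, and the
extension restricts to `U = ε⁻² (p - A u)` on `ℝ`, with `A* U = u`.

All limits follow from two facts about `p`. It lies in the closure of the range of `A`
(`szegoLp_mem_closure_range`): if `f` is orthogonal to the range, the Cauchy integral `A* f`
vanishes on `Γ`, hence at `z` by the identity theorem. It is not in the range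
(`szegoLp_notMem_range`): `p_z = 𝒦u` on `ℝ` would continue analytically to `conj z`, where `p_z` has
a pole and `𝒦u` has none. This continuation needs `z` in the unbounded component, which is automatic
for an arc (`not_isBounded_component_compl_arc`).

Abstractly, density gives `A u → p` and `ε‖u‖ → 0`; non-attainment gives `‖u‖ → ∞`; the weak limits
are tested on the ranges of `A*` and `A`. -/

section Tikhonov

/-! ### Tikhonov regularization in Hilbert spaces. -/

variable {H E : Type*} [NormedAddCommGroup H] [InnerProductSpace ℂ H] [CompleteSpace H]
  [NormedAddCommGroup E] [InnerProductSpace ℂ E] [CompleteSpace E]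

/-- `u` is the Tikhonov regularized solution, with parameter `ε`, of `A u = p`. -/
def IsTikhonov (A : H →L[ℂ] E) (p : E) (ε : ℝ) (u : H) : Prop :=
  A.adjoint (A u) + (ε : ℂ) ^ 2 • u = A.adjoint p

theorem IsTikhonov.adjoint_residual {A : H →L[ℂ] E} {p : E} {ε : ℝ} {u : H}
    (h : IsTikhonov A p ε u) : A.adjoint (p - A u) = (ε : ℂ) ^ 2 • u := by
  rw [map_sub, ← h, add_sub_cancel_left]

theorem IsTikhonov.inner_residual {A : H →L[ℂ] E} {p : E} {ε : ℝ} {u : H}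
    (h : IsTikhonov A p ε u) (w : H) :
    (inner ℂ (p - A u) (A w)).re = ε ^ 2 * (inner ℂ u w).re := by
  rw [← ContinuousLinearMap.adjoint_inner_left, h.adjoint_residual, inner_smul_left]
  rw [← Complex.ofReal_pow, Complex.conj_ofReal, Complex.re_ofReal_mul]

theorem re_inner_le_norm' {F : Type*} [NormedAddCommGroup F] [InnerProductSpace ℂ F] (x y : F) :
    (inner ℂ x y).re ≤ ‖x‖ * ‖y‖ := re_inner_le_norm (𝕜 := ℂ) x y

theorem re_inner_self' {F : Type*} [NormedAddCommGroup F] [InnerProductSpace ℂ F] (x : F) :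
    (inner ℂ x x).re = ‖x‖ ^ 2 := by
  simpa using inner_self_eq_norm_sq (𝕜 := ℂ) x

/-- The regularized solution minimizes `‖p - A w‖² + ε²‖w‖²`; `w` is an arbitrary competitor. -/
theorem IsTikhonov.residual_sq_add_le {A : H →L[ℂ] E} {p : E} {ε : ℝ} {u : H}
    (h : IsTikhonov A p ε u) (hε : 0 < ε) (w : H) :
    ‖p - A u‖ ^ 2 + (ε * ‖u‖) ^ 2 ≤ (ε * ‖w‖) ^ 2 + ‖p - A w‖ ^ 2 := by
  set q := p - A u with hq
  have h1 := h.inner_residual u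
  have h2 := h.inner_residual w
  rw [← hq] at h1 h2
  rw [re_inner_self'] at h1
  have h3 : (inner ℂ q q).re = (inner ℂ q (A w)).re + (inner ℂ q (p - A w)).re
      - (inner ℂ q (A u)).re := by
    rw [← Complex.add_re, ← Complex.sub_re, ← inner_add_right, ← inner_sub_right]
    congr 2
    rw [hq]; abel
  rw [re_inner_self', h1, h2] at h3
  have h4 := re_inner_le_norm' u w
  have h5 := re_inner_le_norm' q (p - A w)
  have h6 : ε ^ 2 * (inner ℂ u w).re ≤ ε ^ 2 * (‖u‖ * ‖w‖) := by gcongr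
  nlinarith [sq_nonneg (ε * ‖u‖ - ε * ‖w‖), sq_nonneg (‖q‖ - ‖p - A w‖)]

theorem tikhonov_tendsto_residual {A : H →L[ℂ] E} {p : E} {u : ℝ → H}
    (hu : ∀ ε, 0 < ε → IsTikhonov A p ε (u ε)) (hp : p ∈ closure (range A)) :
    Tendsto (fun ε => ‖p - A (u ε)‖ ^ 2 + (ε * ‖u ε‖) ^ 2) (𝓝[>] 0) (𝓝 0) := by
  rw [Metric.tendsto_nhds]
  intro δ hδ
  obtain ⟨_, ⟨w, rfl⟩, hw⟩ := Metric.mem_closure_iff.1 hp (√(δ / 2)) (by positivity)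
  have h1 : Tendsto (fun ε : ℝ => (ε * ‖w‖) ^ 2) (𝓝[>] 0) (𝓝 0) := by
    have : Continuous (fun ε : ℝ => (ε * ‖w‖) ^ 2) := by fun_prop
    simpa using (this.tendsto 0).mono_left nhdsWithin_le_nhds
  filter_upwards [h1.eventually (gt_mem_nhds (half_pos hδ)), self_mem_nhdsWithin] with ε h2 hε
  rw [dist_eq_norm] at hw
  have h3 : ‖p - A w‖ ^ 2 < δ / 2 := by
    rw [← Real.sq_sqrt (half_pos hδ).le]
    gcongr
  have h4 := (hu ε hε).residual_sq_add_le hε w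
  rw [Real.dist_eq, sub_zero, abs_of_nonneg (by positivity)]
  linarith

theorem tikhonov_isLittleO {A : H →L[ℂ] E} {p : E} {u : ℝ → H}
    (hu : ∀ ε, 0 < ε → IsTikhonov A p ε (u ε)) (hp : p ∈ closure (range A)) :
    (fun ε : ℝ => ‖u ε‖) =o[𝓝[>] 0] (fun ε : ℝ => ε⁻¹) := by
  have h1 : Tendsto (fun ε => (ε * ‖u ε‖) ^ 2) (𝓝[>] 0) (𝓝 0) :=
    squeeze_zero (fun _ => sq_nonneg _) (fun ε => by nlinarith [sq_nonneg ‖p - A (u ε)‖])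
      (tikhonov_tendsto_residual hu hp)
  have h2 : Tendsto (fun ε => |ε * ‖u ε‖|) (𝓝[>] 0) (𝓝 0) := by
    simpa [Real.sqrt_sq_eq_abs] using h1.sqrt
  rw [isLittleO_iff_tendsto']
  · refine (tendsto_zero_iff_abs_tendsto_zero _).2 (h2.congr fun ε => ?_)
    simp [mul_comm]
  · filter_upwards [self_mem_nhdsWithin] with ε (hε : 0 < ε) h
    exact absurd h (inv_pos.2 hε).ne'

theorem tikhonov_tendsto_apply {A : H →L[ℂ] E} {p : E} {u : ℝ → H}
    (hu : ∀ ε, 0 < ε → IsTikhonov A p ε (u ε)) (hp : p ∈ closure (range A)) :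
    Tendsto (fun ε => A (u ε)) (𝓝[>] 0) (𝓝 p) := by
  have h1 : Tendsto (fun ε => ‖p - A (u ε)‖ ^ 2) (𝓝[>] 0) (𝓝 0) :=
    squeeze_zero (fun _ => sq_nonneg _) (fun ε => by nlinarith [sq_nonneg (ε * ‖u ε‖)])
      (tikhonov_tendsto_residual hu hp)
  have h2 : Tendsto (fun ε => ‖p - A (u ε)‖) (𝓝[>] 0) (𝓝 0) := by
    simpa [Real.sqrt_sq_eq_abs] using h1.sqrt
  rw [tendsto_iff_norm_sub_tendsto_zero]
  exact h2.congr fun ε => norm_sub_rev _ _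

/-- The claim amounts to `‖v‖² ≤ s` with `s = Re⟨u, v⟩`. Subtracting the two normal equations gives
`0 ≤ ‖A (u - v)‖² = δ²(s - ‖v‖²) - ε²(‖u‖² - s)`. If `s < ‖v‖²`, replacing `δ` by `ε` only increases
the right side, which becomes `-ε²‖v - u‖² < 0`. -/
theorem IsTikhonov.norm_sub_sq_le {A : H →L[ℂ] E} {p : E} {ε δ : ℝ} {u v : H}
    (hu : IsTikhonov A p ε u) (hv : IsTikhonov A p δ v) (hε : 0 < ε) (hεδ : ε ≤ δ) :
    ‖v - u‖ ^ 2 ≤ ‖u‖ ^ 2 - ‖v‖ ^ 2 := by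
  have h1 := hu.inner_residual (u - v)
  have h2 := hv.inner_residual (u - v)
  have h3 : (inner ℂ (p - A v) (A (u - v))).re - (inner ℂ (p - A u) (A (u - v))).re
      = ‖A (u - v)‖ ^ 2 := by
    rw [← re_inner_self', ← Complex.sub_re, ← inner_sub_left]
    congr 2
    rw [map_sub]; abel
  rw [h1, h2, inner_sub_right, inner_sub_right, Complex.sub_re, Complex.sub_re, re_inner_self',
    re_inner_self'] at h3
  have h5 : (inner ℂ v u).re = (inner ℂ u v).re := inner_re_symm (𝕜 := ℂ) v u
  have h6 : ‖v - u‖ ^ 2 = ‖v‖ ^ 2 - 2 * (inner ℂ u v).re + ‖u‖ ^ 2 := by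
    rw [← h5]; exact norm_sub_sq (𝕜 := ℂ) v u
  rw [h5] at h3
  set s := (inner ℂ u v).re
  have h7 := sq_nonneg ‖A (u - v)‖
  rcases eq_or_ne v u with rfl | hne
  · simp
  have h8 : 0 < ‖v - u‖ ^ 2 := by
    have := norm_pos_iff.2 (sub_ne_zero.2 hne)
    positivity
  suffices 0 ≤ s - ‖v‖ ^ 2 by nlinarith
  by_contra! hneg
  have h9 : ε ^ 2 ≤ δ ^ 2 := by gcongr
  have h10 : 0 < ε ^ 2 := by positivity
  nlinarith [mul_nonneg (sub_nonneg.2 h9) (neg_pos.2 hneg).le, mul_pos h10 h8]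

/-- The norms increase as `ε` decreases. Were they bounded, their squares would converge along
`1/(n+1)`, so the solutions would be Cauchy by `norm_sub_sq_le`, and their limit `v` would satisfy
`A v = p`. -/
theorem tikhonov_norm_tendsto_atTop {A : H →L[ℂ] E} {p : E} {u : ℝ → H}
    (hu : ∀ ε, 0 < ε → IsTikhonov A p ε (u ε)) (hp : p ∈ closure (range A))
    (hp' : p ∉ range A) : Tendsto (fun ε => ‖u ε‖) (𝓝[>] 0) atTop := by
  have anti : ∀ ε δ, 0 < ε → ε ≤ δ → ‖u δ - u ε‖ ^ 2 ≤ ‖u ε‖ ^ 2 - ‖u δ‖ ^ 2 := fun ε δ hε h =>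
    (hu ε hε).norm_sub_sq_le (hu δ (hε.trans_le h)) hε h
  have anti' : ∀ ε δ, 0 < ε → ε ≤ δ → ‖u δ‖ ≤ ‖u ε‖ := fun ε δ hε h => by
    have := anti ε δ hε h
    exact le_of_sq_le_sq (by nlinarith [sq_nonneg ‖u δ - u ε‖]) (norm_nonneg _)
  rw [tendsto_atTop]
  intro C
  by_contra hC
  have bound : ∀ ε, 0 < ε → ‖u ε‖ ≤ C := by
    intro ε hε
    by_contra! h
    refine hC ?_
    filter_upwards [Ioc_mem_nhdsGT hε] with δ hδ
    exact h.le.trans (anti' δ ε hδ.1 hδ.2)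
  set e : ℕ → ℝ := fun n => 1 / ((n : ℝ) + 1)
  have he : ∀ n, 0 < e n := fun n => by positivity
  have hanti : Antitone e := fun m n h => by
    simp only [e]; gcongr
  have hmono : Monotone fun n => ‖u (e n)‖ ^ 2 := fun m n h => by
    have := anti' _ _ (he n) (hanti h)
    dsimp only; gcongr
  have hbdd : BddAbove (range fun n => ‖u (e n)‖ ^ 2) := by
    refine ⟨C ^ 2, ?_⟩
    rintro _ ⟨n, rfl⟩
    have := bound _ (he n)
    dsimp only; gcongr
  have hc := (tendsto_atTop_ciSup hmono hbdd).cauchySeq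
  have hcu : CauchySeq fun n => u (e n) := by
    rw [Metric.cauchySeq_iff'] at hc ⊢
    intro δ hδ
    obtain ⟨N, hN⟩ := hc (δ ^ 2) (by positivity)
    refine ⟨N, fun n hn => ?_⟩
    have h1 := hN n hn
    rw [Real.dist_eq] at h1
    rw [dist_comm, dist_eq_norm]
    have h2 := anti _ _ (he n) (hanti hn)
    exact lt_of_pow_lt_pow_left₀ 2 hδ.le (h2.trans_lt ((le_abs_self _).trans_lt h1))
  obtain ⟨v, hv⟩ := cauchySeq_tendsto_of_complete hcu
  refine hp' ⟨v, tendsto_nhds_unique ((A.continuous.tendsto v).comp hv) ?_⟩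
  refine (tikhonov_tendsto_apply hu hp).comp (tendsto_nhdsWithin_iff.2
    ⟨tendsto_one_div_add_atTop_nhds_zero_nat, Eventually.of_forall he⟩)

-- Only the projection of `g` to the closed range of `B` pairs with `v i`, and for vectors of norm
-- at most 1 it is enough to test on a dense set.
omit [CompleteSpace E] in
theorem tendsto_inner_of_dense {ι : Type*} {l : Filter ι} {B : E →L[ℂ] H} {v : ι → H}
    (hv : ∀ i, ‖v i‖ ≤ 1) (hvB : ∀ᶠ i in l, v i ∈ closure (range B))
    (h0 : ∀ w, Tendsto (fun i => inner ℂ (B w) (v i)) l (𝓝 0)) (g : H) :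
    Tendsto (fun i => inner ℂ g (v i)) l (𝓝 0) := by
  set M : Submodule ℂ H := B.range.topologicalClosure with hM
  have hMc : (M : Set H) = closure (range B) := by
    rw [hM, Submodule.topologicalClosure_coe]; rfl
  have : CompleteSpace M := (Submodule.isClosed_topologicalClosure _).completeSpace_coe
  have key : ∀ g ∈ closure (range B), Tendsto (fun i => inner ℂ g (v i)) l (𝓝 0) := by
    intro g hg
    rw [Metric.tendsto_nhds]
    intro δ hδ
    obtain ⟨_, ⟨w, rfl⟩, hw⟩ := Metric.mem_closure_iff.1 hg (δ / 2) (half_pos hδ)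
    filter_upwards [Metric.tendsto_nhds.1 (h0 w) (δ / 2) (half_pos hδ)] with i hi
    rw [dist_zero_right] at hi ⊢
    rw [dist_eq_norm] at hw
    have : inner ℂ g (v i) = inner ℂ (g - B w) (v i) + inner ℂ (B w) (v i) := by
      rw [← inner_add_left, sub_add_cancel]
    rw [this]
    have h2 := norm_inner_le_norm (𝕜 := ℂ) (g - B w) (v i)
    have h3 : ‖g - B w‖ * ‖v i‖ ≤ ‖g - B w‖ * 1 := by gcongr; exact hv i
    have h4 := norm_add_le (inner ℂ (g - B w) (v i)) (inner ℂ (B w) (v i))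
    linarith
  refine (key (M.starProjection g) ?_).congr' ?_
  · rw [← hMc]; exact M.starProjection_apply_mem g
  · filter_upwards [hvB] with i hi
    have hi' : v i ∈ M := by rw [← SetLike.mem_coe, hMc]; exact hi
    rw [Submodule.inner_starProjection_left_eq_right,
      Submodule.starProjection_eq_self_iff.2 hi']

theorem norm_inv_smul_le_one {F : Type*} [NormedAddCommGroup F] [NormedSpace ℂ F] (x : F) :
    ‖((‖x‖ : ℂ))⁻¹ • x‖ ≤ 1 := by
  rw [norm_smul, norm_inv, Complex.norm_real, norm_norm]
  exact inv_mul_le_one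

/-- Since `u = A* U`, it suffices to test against `A* w`: the pairing is `⟨w, A u⟩ / ‖u‖`, whose
numerator converges to `⟨w, p⟩`. -/
theorem tikhonov_weak {A : H →L[ℂ] E} {p : E} {u : ℝ → H}
    (hu : ∀ ε, 0 < ε → IsTikhonov A p ε (u ε)) (hp : p ∈ closure (range A))
    (hp' : p ∉ range A) (g : H) :
    Tendsto (fun ε => inner ℂ g ((‖u ε‖ : ℂ)⁻¹ • u ε)) (𝓝[>] 0) (𝓝 0) := by
  refine tendsto_inner_of_dense (B := A.adjoint) (fun ε => norm_inv_smul_le_one _) ?_ ?_ g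
  · filter_upwards [self_mem_nhdsWithin] with ε (hε : 0 < ε)
    refine subset_closure ⟨(‖u ε‖ : ℂ)⁻¹ • ((ε : ℂ) ^ 2)⁻¹ • (p - A (u ε)), ?_⟩
    rw [map_smul, map_smul, (hu ε hε).adjoint_residual, smul_smul ((ε : ℂ) ^ 2)⁻¹,
      inv_mul_cancel₀ (by simpa using hε.ne'), one_smul]
  · intro w
    have h1 : Tendsto (fun ε => (‖u ε‖ : ℂ)⁻¹) (𝓝[>] 0) (𝓝 0) := by
      have := (tikhonov_norm_tendsto_atTop hu hp hp').inv_tendsto_atTop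
      have h2 := (Complex.continuous_ofReal.tendsto 0).comp this
      simpa [Function.comp_def] using h2
    have h2 : Tendsto (fun ε => inner ℂ w (A (u ε))) (𝓝[>] 0) (𝓝 (inner ℂ w p)) :=
      (tendsto_const_nhds (x := w)).inner (tikhonov_tendsto_apply hu hp)
    have h3 := h1.mul h2
    rw [zero_mul] at h3
    refine h3.congr fun ε => ?_
    rw [inner_smul_right, ContinuousLinearMap.adjoint_inner_left]

/-- Testing against `A w` gives `⟨w, u⟩ / ‖U‖`. Pairing `p = A u + ε² U` with `U` yields `‖u‖² ≤ ‖U‖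
‖p‖`, so `‖u‖ / ‖U‖ ≤ √(‖p‖ / ‖U‖) → 0`. -/
theorem tikhonov_extension_weak {A : H →L[ℂ] E} {p : E} {u : ℝ → H} {U : ℝ → E}
    (hu : ∀ ε, 0 < ε → IsTikhonov A p ε (u ε)) (hp : p ∈ closure (range A))
    (hp' : p ∉ range A) (hU : ∀ ε, 0 < ε → U ε = ((ε : ℂ) ^ 2)⁻¹ • (p - A (u ε))) (g : E) :
    Tendsto (fun ε => inner ℂ g ((‖U ε‖ : ℂ)⁻¹ • U ε)) (𝓝[>] 0) (𝓝 0) := by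
  have hAU : ∀ ε, 0 < ε → A.adjoint (U ε) = u ε := fun ε hε => by
    rw [hU ε hε, map_smul, (hu ε hε).adjoint_residual, smul_smul,
      inv_mul_cancel₀ (by simpa using hε.ne'), one_smul]
  have hUtop : Tendsto (fun ε => ‖U ε‖) (𝓝[>] 0) atTop := by
    have h1 := tikhonov_norm_tendsto_atTop hu hp hp'
    have h2 : Tendsto (fun ε => (‖A.adjoint‖ + 1)⁻¹ * ‖u ε‖) (𝓝[>] 0) atTop :=
      h1.const_mul_atTop (by positivity)
    refine tendsto_atTop_mono' _ ?_ h2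
    filter_upwards [self_mem_nhdsWithin] with ε (hε : 0 < ε)
    rw [inv_mul_le_iff₀ (by positivity), ← hAU ε hε]
    have := A.adjoint.le_opNorm (U ε)
    nlinarith [norm_nonneg (U ε)]
  have hquot : Tendsto (fun ε => ‖((‖U ε‖ : ℂ))⁻¹ • u ε‖) (𝓝[>] 0) (𝓝 0) := by
    have h1 : Tendsto (fun ε => √(‖p‖ * ‖U ε‖⁻¹)) (𝓝[>] 0) (𝓝 0) := by
      simpa using (hUtop.inv_tendsto_atTop.const_mul ‖p‖).sqrt
    refine squeeze_zero' (Eventually.of_forall fun _ => norm_nonneg _) ?_ h1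
    filter_upwards [self_mem_nhdsWithin, hUtop.eventually_gt_atTop 0] with ε (hε : 0 < ε) hpos
    refine Real.le_sqrt_of_sq_le ?_
    rw [norm_smul, norm_inv, Complex.norm_real, norm_norm]
    have hp1 : p = A (u ε) + (ε : ℂ) ^ 2 • U ε := by
      rw [hU ε hε, smul_smul, mul_inv_cancel₀ (by simpa using hε.ne'), one_smul,
        add_sub_cancel]
    have h2 : (inner ℂ (U ε) p).re = ‖u ε‖ ^ 2 + ε ^ 2 * ‖U ε‖ ^ 2 := by
      conv_lhs => rw [hp1]
      rw [inner_add_right, ← ContinuousLinearMap.adjoint_inner_left, hAU ε hε, inner_smul_right,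
        Complex.add_re, re_inner_self', ← Complex.ofReal_pow, Complex.re_ofReal_mul,
        re_inner_self']
    have h3 := re_inner_le_norm' (U ε) p
    have h4 : ‖u ε‖ ^ 2 ≤ ‖U ε‖ * ‖p‖ := by nlinarith [sq_nonneg (ε * ‖U ε‖)]
    calc (‖U ε‖⁻¹ * ‖u ε‖) ^ 2 = (‖U ε‖⁻¹) ^ 2 * ‖u ε‖ ^ 2 := by ring
      _ ≤ (‖U ε‖⁻¹) ^ 2 * (‖U ε‖ * ‖p‖) := by gcongr
      _ = ‖p‖ * ‖U ε‖⁻¹ := by field_simp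
  refine tendsto_inner_of_dense (B := A) (fun ε => norm_inv_smul_le_one _) ?_ ?_ g
  · filter_upwards [self_mem_nhdsWithin] with ε (hε : 0 < ε)
    have hM : closure (range A) = (A.range.topologicalClosure : Set E) := by
      rw [Submodule.topologicalClosure_coe]; rfl
    rw [hM] at hp ⊢
    rw [hU ε hε]
    refine Submodule.smul_mem _ _ (Submodule.smul_mem _ _ (Submodule.sub_mem _ hp ?_))
    exact Submodule.le_topologicalClosure _ ⟨_, rfl⟩
  · intro w
    have h1 := (tendsto_const_nhds (x := w)).inner (𝕜 := ℂ) (tendsto_zero_iff_norm_tendsto_zero.2 hquot)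
    rw [inner_zero_right] at h1
    refine h1.congr' ?_
    filter_upwards [self_mem_nhdsWithin] with ε (hε : 0 < ε)
    rw [← ContinuousLinearMap.adjoint_inner_right, map_smul, hAU ε hε]

end Tikhonov

/-! ### Continuous logarithms and components of plane complements. -/

theorem exists_continuous_log {X : Type*} [TopologicalSpace X] [SimplyConnectedSpace X]
    [LocallyPathConnectedSpace X] (f : C(X, ℂ)) (hf : ∀ x, f x ≠ 0) :
    ∃ g : C(X, ℂ), ∀ x, Complex.exp (g x) = f x := by
  obtain ⟨x₀⟩ : Nonempty X := inferInstance
  obtain ⟨g, ⟨-, hg⟩, -⟩ := Complex.isCoveringMapOn_exp.existsUnique_continuousMap_lifts f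
    (Complex.exp_log (hf x₀)) hf
  exact ⟨g, fun x => congr_fun hg x⟩

theorem frontier_connectedComponentIn_subset {X : Type*} [TopologicalSpace X]
    [LocallyConnectedSpace X] {s : Set X} (hs : IsClosed s) (x : X) :
    frontier (connectedComponentIn sᶜ x) ⊆ s := by
  intro y hy
  by_contra hys
  have hopen : IsOpen (connectedComponentIn sᶜ x) := hs.isOpen_compl.connectedComponentIn
  rw [hopen.frontier_eq] at hy
  have hy' : IsOpen (connectedComponentIn sᶜ y) := hs.isOpen_compl.connectedComponentIn
  obtain ⟨w, hw1, hw2⟩ := mem_closure_iff.1 hy.1 _ hy' (mem_connectedComponentIn hys)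
  refine hy.2 ?_
  rw [connectedComponentIn_eq hw2, ← connectedComponentIn_eq hw1]
  exact mem_connectedComponentIn hys

/-- There is no continuous logarithm of `w - z` on a circle around `z`. -/
theorem not_exists_log_on_circle (z : ℂ) {R : ℝ} (hR : 0 < R) (G : ℂ → ℂ) (hG : Continuous G)
    (h : ∀ w, ‖w - z‖ = R → Complex.exp (G w) = w - z) : False := by
  set k : ℝ → ℂ := fun θ => G (z + R * Complex.exp (θ * Complex.I)) - θ * Complex.I with hk
  have hkc : Continuous k := by fun_prop
  have hexp : ∀ θ, Complex.exp (k θ) = R := by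
    intro θ
    rw [hk, Complex.exp_sub, h]
    · field_simp [Complex.exp_ne_zero]
      ring
    · simp [Complex.norm_exp_ofReal_mul_I, hR.le]
  -- `k` lifts the constant `R` through `exp`, hence is constant; yet `k (2π) = k 0 - 2πi`.
  have hconst := Complex.isCoveringMap_exp.eq_of_comp_eq (g₁ := k) (g₂ := fun _ => k 0) hkc
    continuous_const (by ext θ; simp [hexp]) 0 rfl
  have h2 := congr_fun hconst (2 * Real.pi)
  simp only [hk] at h2
  have h3 : Complex.exp (((2 * Real.pi : ℝ) : ℂ) * Complex.I) = 1 := by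
    push_cast; exact Complex.exp_two_pi_mul_I
  rw [h3] at h2
  simp [Real.pi_ne_zero] at h2

/-- An arc does not separate the plane. -/
theorem not_isBounded_component_compl_arc {e : Icc (0 : ℝ) 1 → ℂ} (he : Continuous e)
    (hinj : Function.Injective e) {z : ℂ} (hz : z ∉ range e) :
    ¬ Bornology.IsBounded (connectedComponentIn (range e)ᶜ z) := by
  intro hb
  have hemb : IsClosedEmbedding e := he.isClosedEmbedding hinj
  set V := connectedComponentIn (range e)ᶜ z with hV
  have hzV : z ∈ V := mem_connectedComponentIn hz
  have hVV : V ⊆ (range e)ᶜ := connectedComponentIn_subset _ _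
  -- A logarithm of `w - z` along the arc, which Tietze then extends to the plane.
  obtain ⟨l, hl⟩ := exists_continuous_log (X := ℝ)
    ⟨fun t => e (projIcc 0 1 zero_le_one t) - z, by fun_prop⟩
    (fun t h => hz ⟨_, sub_eq_zero.1 h⟩)
  obtain ⟨L, hL⟩ := ContinuousMap.exists_extension hemb
    (⟨fun t => l t, by fun_prop⟩ : C(Icc (0 : ℝ) 1, ℂ))
  have hLe : ∀ w ∈ range e, Complex.exp (L w) = w - z := by
    rintro _ ⟨t, rfl⟩
    have h1 : L (e t) = l t := DFunLike.congr_fun hL t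
    rw [h1, hl]
    simp
  classical
  -- The two pieces agree on the frontier of `V`, which lies in the arc. `F` has no zero, so it has
  -- a global logarithm, although it equals `w - z` on a large circle.
  set F : ℂ → ℂ := V.piecewise (fun w => Complex.exp (L w)) (fun w => w - z) with hF
  have hFc : Continuous F := Continuous.piecewise
    (fun w hw => hLe w (frontier_connectedComponentIn_subset hemb.isClosed_range z hw))
    (by fun_prop) (by fun_prop)
  have hF0 : ∀ w, F w ≠ 0 := by
    intro w
    by_cases hw : w ∈ V
    · simp [hF, hw, Complex.exp_ne_zero]
    · rw [hF, piecewise_eq_of_notMem _ _ _ hw, sub_ne_zero]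
      rintro rfl
      exact hw hzV
  obtain ⟨G, hG⟩ := exists_continuous_log ⟨F, hFc⟩ hF0
  obtain ⟨R, hR⟩ := hb.subset_closedBall z
  refine not_exists_log_on_circle z (R := max R 0 + 1) (by positivity) G G.continuous ?_
  intro w hw
  have hwV : w ∉ V := fun h => by
    have := hR h
    rw [Metric.mem_closedBall, dist_eq_norm] at this
    linarith [le_max_left R 0]
  rw [hG]
  simp [hF, hwV]

/-- An unbounded component of the complement of a bounded set of the plane contains the
complement of every ball containing that set. -/
theorem compl_closedBall_subset_component {s : Set ℂ} {z : ℂ} {R : ℝ} (hR : 0 < R)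
    (hs : s ⊆ Metric.closedBall 0 R)
    (hb : ¬ Bornology.IsBounded (connectedComponentIn sᶜ z)) :
    (Metric.closedBall (0 : ℂ) R)ᶜ ⊆ connectedComponentIn sᶜ z := by
  have h1 : IsPreconnected (Metric.closedBall (0 : ℂ) R)ᶜ := by
    -- The exterior of a disc is connected, being the image of a half-plane under `exp`.
    have h : (Metric.closedBall (0 : ℂ) R)ᶜ = Complex.exp '' {w | Real.log R < w.re} := by
      ext w
      simp only [mem_compl_iff, mem_closedBall_zero_iff, not_le, mem_image, mem_ofPred_eq]
      constructor
      · intro hw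
        refine ⟨Complex.log w, ?_, Complex.exp_log (norm_pos_iff.1 (hR.trans hw))⟩
        rw [Complex.log_re]
        exact Real.log_lt_log hR hw
      · rintro ⟨w, hw, rfl⟩
        rw [Complex.norm_exp]
        exact (Real.log_lt_iff_lt_exp hR).1 hw
    rw [h]
    exact (convex_halfSpace_re_gt _).isPreconnected.image _ Complex.continuous_exp.continuousOn
  have h2 : ∃ x ∈ connectedComponentIn sᶜ z, x ∉ Metric.closedBall (0 : ℂ) R := by
    by_contra! h
    exact hb (Metric.isBounded_closedBall.subset h)
  obtain ⟨x, hx, hxR⟩ := h2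
  rw [connectedComponentIn_eq hx]
  exact h1.subset_connectedComponentIn hxR (compl_subset_compl.2 hs)

/-! ### Cauchy transforms, kernel decay and the basic integral over the line. -/

theorem differentiableAt_cauchyTransform {X : Type*} [MeasurableSpace X] {ν : Measure X}
    {φ g : X → ℂ} (hφ : AEMeasurable φ ν) (hg : AEStronglyMeasurable g ν) {w : ℂ} {r : ℝ}
    (hr : 0 < r) (h : ∀ᵐ x ∂ν, r ≤ ‖w - φ x‖) (hint : Integrable (fun x => g x / (w - φ x)) ν) :
    DifferentiableAt ℂ (fun w => ∫ x, g x / (w - φ x) ∂ν) w := by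
  have hmeas : ∀ w : ℂ, AEStronglyMeasurable (fun x => w - φ x) ν := fun w =>
    (aemeasurable_const.sub hφ).aestronglyMeasurable
  have key : ∀ᵐ x ∂ν, ∀ w' ∈ Metric.ball w (r / 2), ‖w - φ x‖ / 2 ≤ ‖w' - φ x‖ := by
    filter_upwards [h] with x hx w' hw'
    rw [Metric.mem_ball, dist_eq_norm, norm_sub_rev] at hw'
    have := norm_add_le (w - w') (w' - φ x)
    rw [sub_add_sub_cancel] at this
    linarith
  refine (hasDerivAt_integral_of_dominated_loc_of_deriv_le (μ := ν)
    (F := fun w x => g x / (w - φ x)) (F' := fun w x => -(g x / (w - φ x) ^ 2))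
    (bound := fun x => 4 / r * ‖g x / (w - φ x)‖) (Metric.ball_mem_nhds w (half_pos hr))
    (Eventually.of_forall fun w' => hg.div₀ (hmeas w')) hint
    (hg.div₀ ((hmeas w).pow 2)).neg ?_ (hint.norm.const_mul _) ?_).2.differentiableAt
  · filter_upwards [h, key] with x hx hk w' hw'
    have h1 := hk w' hw'
    have h2 : 0 < ‖w - φ x‖ := hr.trans_le hx
    rw [norm_neg, norm_div, norm_div, norm_pow, ← mul_div_assoc, div_mul_eq_mul_div, div_div]
    calc ‖g x‖ / ‖w' - φ x‖ ^ 2 ≤ ‖g x‖ / (‖w - φ x‖ / 2) ^ 2 := by gcongr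
      _ = 4 * ‖g x‖ / (‖w - φ x‖ * ‖w - φ x‖) := by field_simp; ring
      _ ≤ 4 * ‖g x‖ / (r * ‖w - φ x‖) := by gcongr
  · filter_upwards [h, key] with x hx hk w' hw'
    have h1 := hk w' hw'
    have h2 : w' - φ x ≠ 0 := norm_pos_iff.1 (by linarith)
    have h3 := ((hasDerivAt_id w').sub_const (φ x)).inv h2
    have h4 := h3.const_mul (g x)
    simp only [id] at h4
    convert! h4 using 1
    ring

theorem one_add_abs_le_mul_norm {R m : ℝ} (hm : 0 < m) {τ : ℂ} (hτ : ‖τ‖ ≤ R)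
    (hτ' : m ≤ τ.im) (ζ : ℂ) (hζ : 0 ≤ ζ.im) :
    1 + |ζ.re| ≤ (1 + (1 + R) / m) * ‖ζ - conj τ‖ := by
  have h1 : |ζ.re - τ.re| ≤ ‖ζ - conj τ‖ := by simpa using Complex.abs_re_le_norm (ζ - conj τ)
  have h2 : m ≤ ‖ζ - conj τ‖ := by
    have := Complex.abs_im_le_norm (ζ - conj τ)
    simp only [Complex.sub_im, Complex.conj_im, sub_neg_eq_add] at this
    linarith [le_abs_self (ζ.im + τ.im)]
  have h3 : |ζ.re| ≤ |ζ.re - τ.re| + |τ.re| := by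
    simpa using abs_add_le (ζ.re - τ.re) τ.re
  have h4 := (Complex.abs_re_le_norm τ).trans hτ
  have h5 : 1 + R ≤ (1 + R) / m * ‖ζ - conj τ‖ := by
    rw [div_mul_eq_mul_div, le_div_iff₀ hm]
    have : 0 ≤ 1 + R := by linarith [norm_nonneg τ]
    gcongr
  linarith

theorem memLp_inv_one_add_abs : MemLp (fun x : ℝ => (1 + |x|)⁻¹) 2 volume := by
  have hc : Continuous fun x : ℝ => (1 + |x|)⁻¹ :=
    (continuous_const.add continuous_abs).inv₀ fun x => (by positivity : 0 < 1 + |x|).ne'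
  rw [memLp_two_iff_integrable_sq hc.aestronglyMeasurable]
  refine integrable_inv_one_add_sq.mono' (hc.pow 2).aestronglyMeasurable
    (Eventually.of_forall fun x => ?_)
  rw [Real.norm_of_nonneg (by positivity), inv_pow]
  gcongr
  nlinarith [abs_nonneg x, sq_abs x]

theorem tendsto_log_sub_log_neg {w : ℂ} {l : Filter ℝ} (hl : l ≤ atTop) :
    Tendsto (fun x : ℝ => Complex.log (x - w) - Real.log x) l (𝓝 0) := by
  have h1 : Tendsto (fun x : ℝ => (1 : ℂ) - w / x) atTop (𝓝 1) := by
    have h : Tendsto (fun x : ℝ => ((x⁻¹ : ℝ) : ℂ)) atTop (𝓝 0) := by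
      simpa [Function.comp_def] using
        (Complex.continuous_ofReal.tendsto 0).comp tendsto_inv_atTop_zero
    simpa [div_eq_mul_inv] using (h.const_mul w).const_sub 1
  have h2 : Tendsto (fun x : ℝ => Complex.log (1 - w / x)) atTop (𝓝 0) := by
    simpa using h1.clog (by simp)
  refine (h2.congr' ?_).mono_left hl
  filter_upwards [eventually_gt_atTop 0, h1.eventually_ne one_ne_zero] with x hx hne
  have : (x : ℂ) - w = (x : ℝ) * (1 - w / x) := by
    have : (x : ℂ) ≠ 0 := by exact_mod_cast hx.ne'
    field_simp
  rw [this, Complex.log_ofReal_mul hx hne, add_sub_cancel_left]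

/-- Dividing by `x` moves the argument to `-1`, on the branch cut; `S` records the side of approach
and so selects the limit `±πi`. -/
theorem tendsto_log_of_im {S : Set ℂ} {L : ℂ} (hlog : Tendsto Complex.log (𝓝[S] (-1)) (𝓝 L))
    {w : ℂ} (hS : ∀ x : ℝ, 0 < x → -1 - w / x ∈ S) :
    Tendsto (fun x : ℝ => Complex.log (((-x : ℝ) : ℂ) - w) - Real.log x) atTop (𝓝 L) := by
  have h1 : Tendsto (fun x : ℝ => (-1 : ℂ) - w / x) atTop (𝓝 (-1)) := by
    have h : Tendsto (fun x : ℝ => ((x⁻¹ : ℝ) : ℂ)) atTop (𝓝 0) := by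
      simpa [Function.comp_def] using
        (Complex.continuous_ofReal.tendsto 0).comp tendsto_inv_atTop_zero
    simpa [div_eq_mul_inv] using (h.const_mul w).const_sub (-1)
  have h2 := hlog.comp (tendsto_nhdsWithin_iff.2
    ⟨h1, (eventually_gt_atTop 0).mono fun x hx => hS x hx⟩)
  refine h2.congr' ?_
  filter_upwards [eventually_gt_atTop 0, h1.eventually_ne (neg_ne_zero.2 one_ne_zero)] with x hx hne
  have : ((-x : ℝ) : ℂ) - w = (x : ℝ) * (-1 - w / x) := by
    have : (x : ℂ) ≠ 0 := by exact_mod_cast hx.ne'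
    push_cast
    field_simp
  rw [this, Complex.log_ofReal_mul hx hne, add_sub_cancel_left]
  rfl

theorem sub_ofReal_ne_zero {a : ℂ} (ha : a.im ≠ 0) (x : ℝ) : (x : ℂ) - a ≠ 0 := by
  intro h
  have := congr_arg Complex.im h
  simp at this
  exact ha this

/-- The primitive is a difference of principal logarithms. It vanishes at `+∞`; at `-∞` the two
arguments approach the cut from opposite sides, which leaves `-2πi`. -/
theorem integral_one_div_sub_conj_mul_sub {a b : ℂ} (ha : 0 < a.im) (hb : 0 < b.im) :
    ∫ x : ℝ, 1 / (((x : ℂ) - conj a) * (x - b)) = 2 * Real.pi * Complex.I / (b - conj a) := by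
  have hne : b - conj a ≠ 0 := by
    intro h
    have := congr_arg Complex.im h
    simp at this
    linarith
  have hca : (conj a).im ≠ 0 := by simpa using ha.ne'
  have hderiv : ∀ x : ℝ, HasDerivAt
      (fun x : ℝ => (Complex.log (x - b) - Complex.log (x - conj a)) / (b - conj a))
      (1 / (((x : ℂ) - conj a) * (x - b))) x := by
    intro x
    have h1 : ∀ c : ℂ, c.im ≠ 0 → HasDerivAt (fun x : ℝ => Complex.log ((x : ℂ) - c))
        (1 / ((x : ℂ) - c)) x := by
      intro c hc
      refine HasDerivAt.clog_real ?_ ?_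
      · simpa using (Complex.ofRealCLM.hasDerivAt (x := x)).sub_const c
      · rw [Complex.mem_slitPlane_iff]; right; simpa using hc
    convert! ((h1 b hb.ne').sub (h1 _ hca)).div_const (b - conj a) using 1
    have := sub_ofReal_ne_zero hb.ne' x
    have := sub_ofReal_ne_zero hca x
    field_simp
    ring
  have hint : Integrable (fun x : ℝ => 1 / (((x : ℂ) - conj a) * (x - b))) := by
    have hc : Continuous (fun x : ℝ => 1 / (((x : ℂ) - conj a) * (x - b))) :=
      continuous_const.div (by fun_prop) fun x =>
        mul_ne_zero (sub_ofReal_ne_zero hca x) (sub_ofReal_ne_zero hb.ne' x)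
    refine (((memLp_two_iff_integrable_sq memLp_inv_one_add_abs.1).1
      memLp_inv_one_add_abs).const_mul ((1 + (1 + ‖a‖) / a.im) * (1 + (1 + ‖b‖) / b.im))).mono'
      hc.aestronglyMeasurable (Eventually.of_forall fun x => ?_)
    have h1 := one_add_abs_le_mul_norm ha le_rfl le_rfl (x : ℂ) (by simp)
    have h2 := one_add_abs_le_mul_norm hb le_rfl le_rfl (x : ℂ) (by simp)
    rw [Complex.ofReal_re] at h1 h2
    have h3 : ‖(x : ℂ) - conj b‖ = ‖(x : ℂ) - b‖ := by
      rw [← Complex.norm_conj]; simp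
    rw [h3] at h2
    have h4 : 0 < ‖(x : ℂ) - b‖ := norm_pos_iff.2 (sub_ofReal_ne_zero hb.ne' x)
    have h5 : 0 < ‖(x : ℂ) - conj a‖ := norm_pos_iff.2 (sub_ofReal_ne_zero hca x)
    rw [norm_div, norm_one, norm_mul, div_le_iff₀ (by positivity), inv_pow]
    have hx : 0 < (1 + |x|) := by positivity
    rw [mul_assoc, inv_mul_eq_div, ← mul_div_assoc, le_div_iff₀ (by positivity), one_mul]
    calc (1 + |x|) ^ 2 = (1 + |x|) * (1 + |x|) := sq _
      _ ≤ _ := mul_le_mul h1 h2 hx.le (by positivity)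
      _ = _ := by ring
  have htop : Tendsto
      (fun x : ℝ => (Complex.log (x - b) - Complex.log (x - conj a)) / (b - conj a)) atTop
      (𝓝 ((0 - 0) / (b - conj a))) := by
    refine Tendsto.div_const ((((tendsto_log_sub_log_neg (w := b) le_rfl).sub
      (tendsto_log_sub_log_neg (w := conj a) le_rfl))).congr fun x => ?_) _
    ring
  have hbot : Tendsto
      (fun x : ℝ => (Complex.log (x - b) - Complex.log (x - conj a)) / (b - conj a)) atBot
      (𝓝 (((Real.log ‖(-1 : ℂ)‖ - Real.pi * Complex.I) -
        (Real.log ‖(-1 : ℂ)‖ + Real.pi * Complex.I)) / (b - conj a))) := by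
    refine Tendsto.div_const ?_ _
    have h1 := tendsto_log_of_im (Complex.tendsto_log_nhdsWithin_im_neg_of_re_neg_of_im_zero
      (z := -1) (by simp) (by simp)) (w := b) (fun x hx => by
        simp only [mem_ofPred_eq, Complex.sub_im, Complex.neg_im, Complex.one_im,
          Complex.div_ofReal_im]
        have : 0 < b.im / x := by positivity
        linarith)
    have h2 := tendsto_log_of_im (Complex.tendsto_log_nhdsWithin_im_nonneg_of_re_neg_of_im_zero
      (z := -1) (by simp) (by simp)) (w := conj a) (fun x hx => by
        simp only [mem_ofPred_eq, Complex.sub_im, Complex.neg_im, Complex.one_im,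
          Complex.div_ofReal_im, Complex.conj_im]
        have : 0 < a.im / x := by positivity
        rw [neg_div]
        linarith)
    refine ((h1.sub h2).comp tendsto_neg_atBot_atTop).congr fun x => ?_
    simp
  rw [integral_of_hasDerivAt_of_tendsto hderiv hint hbot htop]
  field_simp
  ring

/-! ### The Szegő operator, its adjoint and the density of its range. -/

/-- The integral operator with kernel `i / (2π (ζ - conj τ))` with respect to the measure `μ`. -/
noncomputable def szegoIntegral (μ : Measure ℂ) (u : ℂ → ℂ) (ζ : ℂ) : ℂ :=
  (1 / (2 * (Real.pi : ℂ))) * ∫ τ, Complex.I * u τ / (ζ - conj τ) ∂μ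

/-- The measure `μ` lives in the upper half-plane, and the kernels `1 / (ζ - conj τ)` decay
uniformly on the closed upper half-plane, for `τ` in the support. -/
structure HasKernelBound (μ : Measure ℂ) (D : ℝ) : Prop where
  pos : 0 < D
  ae : ∀ᵐ τ ∂μ, 0 < τ.im ∧ ∀ ζ : ℂ, 0 ≤ ζ.im → 1 + |ζ.re| ≤ D * ‖ζ - conj τ‖

section

variable {μ : Measure ℂ} {D : ℝ}

theorem inv_norm_le_of_kernelBound {t d : ℝ} (ht : 0 < t) (h : t ≤ D * d) (hD : 0 < D) :
    d⁻¹ ≤ D * t⁻¹ := by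
  have hd : 0 < d := pos_of_mul_pos_right (ht.trans_le h) hD.le
  rw [inv_le_iff_one_le_mul₀ hd, mul_right_comm, ← div_eq_mul_inv, one_le_div ht]
  exact h

theorem HasKernelBound.integrable (h : HasKernelBound μ D) {u : ℂ → ℂ} (hu : Integrable u μ)
    {ζ : ℂ} (hζ : 0 ≤ ζ.im) : Integrable (fun τ => Complex.I * u τ / (ζ - conj τ)) μ := by
  refine (hu.norm.const_mul (D * (1 + |ζ.re|)⁻¹)).mono' ?_ ?_
  · refine (hu.1.const_mul _).div₀ (Measurable.aestronglyMeasurable ?_)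
    fun_prop
  · filter_upwards [h.ae] with τ hτ
    rw [norm_div, norm_mul, Complex.norm_I, one_mul, div_eq_inv_mul]
    gcongr
    exact inv_norm_le_of_kernelBound (by positivity) (hτ.2 ζ hζ) h.pos

/-- The bound ignores `Im ζ`, so one `L²` majorant serves every horizontal line and the real axis.
-/
theorem HasKernelBound.norm_szegoIntegral_le (h : HasKernelBound μ D) {u : ℂ → ℂ}
    (hu : Integrable u μ) {ζ : ℂ} (hζ : 0 ≤ ζ.im) :
    ‖szegoIntegral μ u ζ‖ ≤ (D * ∫ τ, ‖u τ‖ ∂μ) * (1 + |ζ.re|)⁻¹ := by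
  have h1 : ‖∫ τ, Complex.I * u τ / (ζ - conj τ) ∂μ‖ ≤
      ∫ τ, D * (1 + |ζ.re|)⁻¹ * ‖u τ‖ ∂μ := by
    refine norm_integral_le_of_norm_le (hu.norm.const_mul _) ?_
    filter_upwards [h.ae] with τ hτ
    rw [norm_div, norm_mul, Complex.norm_I, one_mul, div_eq_inv_mul]
    gcongr
    exact inv_norm_le_of_kernelBound (by positivity) (hτ.2 ζ hζ) h.pos
  rw [integral_const_mul] at h1
  have h2 : ‖(1 / (2 * (Real.pi : ℂ)))‖ ≤ 1 := by
    have h3 : (1 : ℂ) / (2 * (Real.pi : ℂ)) = ((1 / (2 * Real.pi) : ℝ) : ℂ) := by push_cast; rfl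
    rw [h3, Complex.norm_real, Real.norm_of_nonneg (by positivity),
      div_le_one (by positivity : 0 < 2 * Real.pi)]
    linarith [Real.pi_gt_three]
  rw [szegoIntegral, norm_mul]
  calc _ ≤ 1 * (D * (1 + |ζ.re|)⁻¹ * ∫ τ, ‖u τ‖ ∂μ) := by gcongr
    _ = _ := by ring

theorem differentiableAt_szegoIntegral {u : ℂ → ℂ} (hu : Integrable u μ) {ζ : ℂ} {r : ℝ}
    (hr : 0 < r) (h : ∀ᵐ τ ∂μ, r ≤ ‖ζ - conj τ‖) :
    DifferentiableAt ℂ (szegoIntegral μ u) ζ := by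
  refine (differentiableAt_cauchyTransform (ν := μ) (φ := fun τ => conj τ)
    (g := fun τ => Complex.I * u τ) (by fun_prop) (hu.1.const_mul _) hr h ?_).const_mul _
  refine (hu.norm.const_mul r⁻¹).mono' ?_ ?_
  · refine (hu.1.const_mul _).div₀ (Measurable.aestronglyMeasurable ?_)
    fun_prop
  · filter_upwards [h] with τ hτ
    rw [norm_div, norm_mul, Complex.norm_I, one_mul, div_eq_inv_mul]
    gcongr

theorem HasKernelBound.differentiableAt (h : HasKernelBound μ D) {u : ℂ → ℂ}
    (hu : Integrable u μ) {ζ : ℂ} (hζ : 0 ≤ ζ.im) :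
    DifferentiableAt ℂ (szegoIntegral μ u) ζ := by
  refine differentiableAt_szegoIntegral hu (inv_pos.2 h.pos) ?_
  filter_upwards [h.ae] with τ hτ
  have := hτ.2 ζ hζ
  rw [inv_le_iff_one_le_mul₀' h.pos]
  linarith [abs_nonneg ζ.re]

theorem HasKernelBound.continuous_ofReal (h : HasKernelBound μ D) {u : ℂ → ℂ}
    (hu : Integrable u μ) : Continuous fun x : ℝ => szegoIntegral μ u x :=
  continuous_iff_continuousAt.2 fun x =>
    (h.differentiableAt hu (ζ := (x : ℂ)) (by simp)).continuousAt.comp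
      Complex.continuous_ofReal.continuousAt

theorem HasKernelBound.memLp_ofReal (h : HasKernelBound μ D) {u : ℂ → ℂ}
    (hu : Integrable u μ) : MemLp (fun x : ℝ => szegoIntegral μ u x) 2 volume := by
  refine (memLp_inv_one_add_abs.const_mul (D * ∫ τ, ‖u τ‖ ∂μ)).mono
    (h.continuous_ofReal hu).aestronglyMeasurable (Eventually.of_forall fun x => ?_)
  have := h.norm_szegoIntegral_le hu (ζ := (x : ℂ)) (by simp)
  rw [Complex.ofReal_re] at this
  exact this.trans (le_abs_self _)

theorem integrable_of_Lp [IsFiniteMeasure μ] (u : Lp ℂ 2 μ) : Integrable u μ :=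
  (Lp.memLp u).integrable one_le_two

theorem integral_norm_le_of_Lp [IsFiniteMeasure μ] (u : Lp ℂ 2 μ) :
    ∫ τ, ‖u τ‖ ∂μ ≤ (μ univ ^ (1 / 2 : ℝ)).toReal * ‖u‖ := by
  rw [integral_norm_eq_lintegral_enorm (integrable_of_Lp u).1, ← eLpNorm_one_eq_lintegral_enorm,
    Lp.norm_def, mul_comm, ← ENNReal.toReal_mul]
  have h := eLpNorm_le_eLpNorm_mul_rpow_measure_univ (μ := μ) one_le_two
    (integrable_of_Lp u).1
  refine ENNReal.toReal_mono (ENNReal.mul_ne_top (Lp.eLpNorm_ne_top u)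
    (ENNReal.rpow_ne_top_of_nonneg (by norm_num) (measure_ne_top _ _))) (h.trans_eq ?_)
  norm_num

/-- Boundary values on the real line of `szegoIntegral`, as an operator between `L²` spaces. -/
noncomputable def szegoOperator [IsFiniteMeasure μ] (h : HasKernelBound μ D) :
    Lp ℂ 2 μ →L[ℂ] Lp ℂ 2 (volume : Measure ℝ) :=
  LinearMap.mkContinuous
    { toFun := fun u => (h.memLp_ofReal (integrable_of_Lp u)).toLp
      map_add' := fun u v => by
        rw [← MemLp.toLp_add]
        refine MemLp.toLp_congr _ _ (Eventually.of_forall fun x => ?_)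
        simp only [szegoIntegral, Pi.add_apply]
        rw [← mul_add, ← integral_add (h.integrable (integrable_of_Lp u) (by simp))
          (h.integrable (integrable_of_Lp v) (by simp))]
        congr 1
        refine integral_congr_ae ?_
        filter_upwards [Lp.coeFn_add u v] with τ hτ
        rw [hτ, Pi.add_apply]
        ring
      map_smul' := fun c u => by
        rw [RingHom.id_apply, ← MemLp.toLp_const_smul]
        refine MemLp.toLp_congr _ _ (Eventually.of_forall fun x => ?_)
        simp only [szegoIntegral, Pi.smul_apply, smul_eq_mul]
        rw [mul_left_comm, ← integral_const_mul c]
        congr 1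
        refine integral_congr_ae ?_
        filter_upwards [Lp.coeFn_smul c u] with τ hτ
        rw [hτ, Pi.smul_apply, smul_eq_mul]
        ring }
    (D * (μ univ ^ (1 / 2 : ℝ)).toReal * ‖memLp_inv_one_add_abs.toLp‖) fun u => by
      have h1 : ‖(h.memLp_ofReal (integrable_of_Lp u)).toLp‖ ≤
          (D * ∫ τ, ‖u τ‖ ∂μ) * ‖memLp_inv_one_add_abs.toLp‖ := by
        refine Lp.norm_le_mul_norm_of_ae_le_mul ?_
        filter_upwards [MemLp.coeFn_toLp (h.memLp_ofReal (integrable_of_Lp u)),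
          memLp_inv_one_add_abs.coeFn_toLp] with x hx hx'
        rw [hx, hx', Real.norm_of_nonneg (by positivity : 0 ≤ (1 + |x|)⁻¹)]
        exact h.norm_szegoIntegral_le (integrable_of_Lp u) (ζ := (x : ℂ)) (by simp)
      refine h1.trans ?_
      have h2 := integral_norm_le_of_Lp u
      have h3 := h.pos
      calc _ ≤ (D * ((μ univ ^ (1 / 2 : ℝ)).toReal * ‖u‖)) * ‖memLp_inv_one_add_abs.toLp‖ := by
            gcongr
        _ = _ := by ring

theorem szegoOperator_coe [IsFiniteMeasure μ] (h : HasKernelBound μ D) (u : Lp ℂ 2 μ) :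
    szegoOperator h u =ᵐ[volume] fun x : ℝ => szegoIntegral μ u x :=
  MemLp.coeFn_toLp (h.memLp_ofReal (integrable_of_Lp u))

/-- The Szegő kernel `i / (2π (ζ - conj τ))` of the upper half-plane. -/
noncomputable def szegoKernel (τ ζ : ℂ) : ℂ :=
  (1 / (2 * (Real.pi : ℂ))) * (Complex.I / (ζ - conj τ))

theorem memLp_szegoKernel {τ : ℂ} (hτ : 0 < τ.im) :
    MemLp (fun x : ℝ => szegoKernel τ x) 2 volume := by
  have hc : Continuous fun x : ℝ => szegoKernel τ x :=
    continuous_const.mul (continuous_const.div (by fun_prop) fun x =>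
      sub_ofReal_ne_zero (by simpa using hτ.ne') x)
  set D := 1 + (1 + ‖τ‖) / τ.im with hD
  have hDpos : 0 < D := by positivity
  refine (memLp_inv_one_add_abs.const_mul (‖(1 / (2 * (Real.pi : ℂ)))‖ * D)).mono
    hc.aestronglyMeasurable (Eventually.of_forall fun x => ?_)
  rw [szegoKernel, norm_mul, norm_div Complex.I, Complex.norm_I, one_div ‖(x : ℂ) - _‖,
    Real.norm_of_nonneg (by positivity), mul_assoc]
  gcongr
  have := one_add_abs_le_mul_norm hτ le_rfl le_rfl (x : ℂ) (by simp)
  rw [Complex.ofReal_re] at this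
  exact inv_norm_le_of_kernelBound (by positivity) this hDpos

/-- The Szegő kernel as an element of `L²(ℝ)`. -/
noncomputable def szegoLp {τ : ℂ} (hτ : 0 < τ.im) : Lp ℂ 2 (volume : Measure ℝ) :=
  (memLp_szegoKernel hτ).toLp

theorem szegoLp_coe {τ : ℂ} (hτ : 0 < τ.im) :
    szegoLp hτ =ᵐ[volume] fun x : ℝ => szegoKernel τ x := MemLp.coeFn_toLp (memLp_szegoKernel hτ)

theorem inner_szegoLp {τ : ℂ} (hτ : 0 < τ.im) (f : Lp ℂ 2 (volume : Measure ℝ)) :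
    inner ℂ f (szegoLp hτ) = ∫ x : ℝ, conj (f x) * szegoKernel τ x := by
  rw [L2.inner_def]
  refine integral_congr_ae ?_
  filter_upwards [szegoLp_coe hτ] with x hx
  rw [hx, RCLike.inner_apply, mul_comm]

theorem inner_szegoLp_szegoLp {a b : ℂ} (ha : 0 < a.im) (hb : 0 < b.im) :
    inner ℂ (szegoLp ha) (szegoLp hb) = szegoKernel b a := by
  have h1 : inner ℂ (szegoLp ha) (szegoLp hb) =
      ∫ x : ℝ, (1 / (2 * (Real.pi : ℂ))) ^ 2 * (1 / (((x : ℂ) - conj b) * (x - a))) := by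
    rw [inner_szegoLp]
    refine integral_congr_ae ?_
    filter_upwards [szegoLp_coe ha] with x hx
    rw [hx, szegoKernel, szegoKernel]
    simp only [map_mul, map_div₀, map_one, map_sub, Complex.conj_conj, Complex.conj_I,
      Complex.conj_ofReal, map_ofNat]
    simp only [div_eq_mul_inv, mul_inv]
    linear_combination (-(1 * (2⁻¹ * (Real.pi : ℂ)⁻¹)) ^ 2 *
      (((x : ℂ) - conj b)⁻¹ * ((x : ℂ) - a)⁻¹)) * Complex.I_sq
  rw [h1, integral_const_mul, integral_one_div_sub_conj_mul_sub hb ha, szegoKernel]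
  have := Complex.ofReal_ne_zero.2 Real.pi_ne_zero
  field_simp

theorem norm_szegoKernel_le (x : ℝ) {τ : ℂ} (hD : 0 < D)
    (hτ : ∀ ζ : ℂ, 0 ≤ ζ.im → 1 + |ζ.re| ≤ D * ‖ζ - conj τ‖) :
    ‖szegoKernel τ x‖ ≤ ‖(1 / (2 * (Real.pi : ℂ)))‖ * (D * (1 + |x|)⁻¹) := by
  rw [szegoKernel, norm_mul, norm_div Complex.I, Complex.norm_I, one_div ‖(x : ℂ) - _‖]
  gcongr
  have := hτ x (by simp)
  rw [Complex.ofReal_re] at this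
  exact inv_norm_le_of_kernelBound (by positivity) this hD

theorem measurable_szegoKernel_prod :
    Measurable fun q : ℂ × ℝ => szegoKernel q.1 q.2 := by
  unfold szegoKernel
  fun_prop

theorem integrable_mul_inv_one_add_abs (f : Lp ℂ 2 (volume : Measure ℝ)) :
    Integrable fun x : ℝ => ‖f x‖ * (1 + |x|)⁻¹ :=
  (Lp.memLp f).norm.integrable_mul memLp_inv_one_add_abs

theorem HasKernelBound.integrable_prod [IsFiniteMeasure μ] (h : HasKernelBound μ D)
    (f : Lp ℂ 2 (volume : Measure ℝ)) {u : ℂ → ℂ} (hu : Integrable u μ) :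
    Integrable (fun q : ℂ × ℝ => u q.1 * (conj (f q.2) * szegoKernel q.1 q.2))
      (μ.prod volume) := by
  refine (((hu.norm.mul_prod (integrable_mul_inv_one_add_abs f)).const_mul
    (‖(1 / (2 * (Real.pi : ℂ)))‖ * D))).mono' ?_ ?_
  · have h1 : AEStronglyMeasurable (fun x => conj (f x)) volume :=
      Complex.continuous_conj.comp_aestronglyMeasurable (Lp.memLp f).1
    exact hu.1.comp_fst.mul (h1.comp_snd.mul measurable_szegoKernel_prod.aestronglyMeasurable)
  · filter_upwards [Measure.quasiMeasurePreserving_fst.ae h.ae] with q hq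
    have := norm_szegoKernel_le q.2 h.pos hq.2
    rw [norm_mul, norm_mul, RCLike.norm_conj]
    calc _ ≤ ‖u q.1‖ * (‖f q.2‖ * (‖(1 / (2 * (Real.pi : ℂ)))‖ * (D * (1 + |q.2|)⁻¹))) := by
          gcongr
      _ = _ := by ring

theorem inner_szegoOperator [IsFiniteMeasure μ] (h : HasKernelBound μ D)
    (f : Lp ℂ 2 (volume : Measure ℝ)) (u : Lp ℂ 2 μ) :
    inner ℂ f (szegoOperator h u) =
      ∫ τ, u τ * (∫ x : ℝ, conj (f x) * szegoKernel τ x) ∂μ := by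
  have h1 : inner ℂ f (szegoOperator h u) =
      ∫ x : ℝ, ∫ τ, u τ * (conj (f x) * szegoKernel τ x) ∂μ := by
    rw [L2.inner_def]
    refine integral_congr_ae ?_
    filter_upwards [szegoOperator_coe h u] with x hx
    rw [hx, RCLike.inner_apply, szegoIntegral, ← integral_const_mul, ← integral_mul_const]
    congr 1
    ext τ
    rw [szegoKernel]
    ring
  rw [h1, integral_integral_swap]
  · simp_rw [integral_const_mul]
  · exact (h.integrable_prod f (integrable_of_Lp u)).swap

theorem HasKernelBound.memLp_conj_integral [IsFiniteMeasure μ] (h : HasKernelBound μ D)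
    (f : Lp ℂ 2 (volume : Measure ℝ)) :
    MemLp (fun τ => conj (∫ x : ℝ, conj (f x) * szegoKernel τ x)) 2 μ := by
  refine MemLp.of_bound (C := ∫ x : ℝ, ‖(1 / (2 * (Real.pi : ℂ)))‖ * D * (‖f x‖ * (1 + |x|)⁻¹))
    (Complex.continuous_conj.comp_aestronglyMeasurable ?_) ?_
  · have h1 := (h.integrable_prod f (integrable_const (1 : ℂ))).1
    simp only [one_mul] at h1
    exact h1.integral_prod_right'
  · filter_upwards [h.ae] with τ hτ
    rw [RCLike.norm_conj]
    refine norm_integral_le_of_norm_le ((integrable_mul_inv_one_add_abs f).const_mul _)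
      (Eventually.of_forall fun x => ?_)
    have := norm_szegoKernel_le x h.pos hτ.2
    rw [norm_mul, RCLike.norm_conj]
    calc _ ≤ ‖f x‖ * (‖(1 / (2 * (Real.pi : ℂ)))‖ * (D * (1 + |x|)⁻¹)) := by gcongr
      _ = _ := by ring

theorem adjoint_szegoOperator_coe [IsFiniteMeasure μ] (h : HasKernelBound μ D)
    (f : Lp ℂ 2 (volume : Measure ℝ)) :
    (szegoOperator h).adjoint f =ᵐ[μ]
      fun τ => conj (∫ x : ℝ, conj (f x) * szegoKernel τ x) := by
  have h1 : (szegoOperator h).adjoint f = (h.memLp_conj_integral f).toLp := by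
    refine ext_inner_right ℂ fun u => ?_
    rw [ContinuousLinearMap.adjoint_inner_left, inner_szegoOperator, L2.inner_def]
    refine integral_congr_ae ?_
    filter_upwards [(h.memLp_conj_integral f).coeFn_toLp] with τ hτ
    rw [hτ, RCLike.inner_apply, Complex.conj_conj]
  rw [h1]
  exact (h.memLp_conj_integral f).coeFn_toLp

theorem adjoint_szegoOperator_ae [IsFiniteMeasure μ] (h : HasKernelBound μ D)
    (f : Lp ℂ 2 (volume : Measure ℝ)) :
    ∀ᵐ τ ∂μ, ∀ hτ : 0 < τ.im,
      (szegoOperator h).adjoint f τ = inner ℂ (szegoLp hτ) f := by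
  filter_upwards [adjoint_szegoOperator_coe h f] with τ hτ hpos
  rw [hτ, ← inner_szegoLp hpos, inner_conj_symm]

/-- The factorization `A* A = 𝒦`: `A* f` at `τ` is the pairing of `f` with the kernel at `τ`, and
two kernels pair to a kernel. -/
theorem adjoint_comp_szegoOperator_coe [IsFiniteMeasure μ] (h : HasKernelBound μ D)
    (u : Lp ℂ 2 μ) :
    (szegoOperator h).adjoint (szegoOperator h u) =ᵐ[μ] szegoIntegral μ u := by
  filter_upwards [adjoint_szegoOperator_ae h (szegoOperator h u), h.ae] with σ hσ hpos
  rw [hσ hpos.1, inner_szegoOperator, szegoIntegral, ← integral_const_mul]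
  refine integral_congr_ae ?_
  filter_upwards [h.ae] with τ hτ
  rw [← inner_szegoLp hτ.1, inner_szegoLp_szegoLp, szegoKernel]
  ring

theorem adjoint_szegoOperator_szegoLp_coe [IsFiniteMeasure μ] (h : HasKernelBound μ D)
    {z : ℂ} (hz : 0 < z.im) :
    (szegoOperator h).adjoint (szegoLp hz) =ᵐ[μ] szegoKernel z := by
  filter_upwards [adjoint_szegoOperator_ae h (szegoLp hz), h.ae] with σ hσ hpos
  rw [hσ hpos.1, inner_szegoLp_szegoLp]

/-- The conjugations cancel: up to a constant this is the Cauchy integral of `f`. -/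
theorem differentiableAt_conj_inner_szegoLp (f : Lp ℂ 2 (volume : Measure ℝ)) {τ : ℂ}
    (hτ : 0 < τ.im) :
    DifferentiableAt ℂ (fun τ => conj (∫ x : ℝ, conj (f x) * szegoKernel τ x)) τ := by
  have h1 : (fun τ : ℂ => conj (∫ x : ℝ, conj (f x) * szegoKernel τ x)) = fun τ =>
      (1 / (2 * (Real.pi : ℂ)) * Complex.I) * ∫ x : ℝ, f x / (τ - x) := by
    ext τ
    rw [← integral_conj, ← integral_const_mul]
    congr 1
    ext x
    simp only [szegoKernel, map_mul, map_div₀, map_one, map_sub, Complex.conj_conj,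
      Complex.conj_I, Complex.conj_ofReal, map_ofNat]
    rw [← neg_sub τ, div_neg, neg_div, neg_neg]
    ring
  rw [h1]
  refine (differentiableAt_cauchyTransform (ν := (volume : Measure ℝ)) (φ := fun x => (x : ℂ))
    (by fun_prop) (Lp.memLp f).1 hτ (Eventually.of_forall fun x => ?_) ?_).const_mul _
  · have := Complex.abs_im_le_norm (τ - x)
    simp only [Complex.sub_im, Complex.ofReal_im, sub_zero] at this
    exact (le_abs_self _).trans this
  · have hD : 0 < 1 + (1 + ‖τ‖) / τ.im := by positivity
    refine ((integrable_mul_inv_one_add_abs f).const_mul (1 + (1 + ‖τ‖) / τ.im)).mono' ?_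
      (Eventually.of_forall fun x => ?_)
    · exact (Lp.memLp f).1.div₀ (by fun_prop)
    · have := one_add_abs_le_mul_norm hτ le_rfl le_rfl (x : ℂ) (by simp)
      have h3 : ‖(x : ℂ) - conj τ‖ = ‖τ - x‖ := by
        rw [← Complex.norm_conj, norm_sub_rev]; simp
      rw [h3, Complex.ofReal_re] at this
      have h4 := inv_norm_le_of_kernelBound (by positivity) this hD
      rw [norm_div, div_eq_mul_inv]
      calc _ ≤ ‖f x‖ * ((1 + (1 + ‖τ‖) / τ.im) * (1 + |x|)⁻¹) := by gcongr
        _ = _ := by ring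

/-- The kernel at `z` is approximated by the range of the operator as soon as `z` belongs to the
uniqueness set of `μ` for holomorphic functions. -/
theorem szegoLp_mem_closure_range [IsFiniteMeasure μ] (h : HasKernelBound μ D)
    {z : ℂ} (hz : 0 < z.im)
    (huniq : ∀ F : ℂ → ℂ, (∀ τ : ℂ, 0 < τ.im → DifferentiableAt ℂ F τ) →
      (∀ᵐ τ ∂μ, F τ = 0) → F z = 0) :
    szegoLp hz ∈ closure (range (szegoOperator h)) := by
  set M := (szegoOperator h).range with hM
  have hMc : closure (range (szegoOperator h)) = (M.topologicalClosure : Set _) := by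
    rw [Submodule.topologicalClosure_coe]; rfl
  rw [hMc, SetLike.mem_coe, ← Submodule.orthogonal_orthogonal_eq_closure,
    Submodule.mem_orthogonal]
  intro f hf
  have hadj : (szegoOperator h).adjoint f = 0 := by
    refine ext_inner_right ℂ fun u => ?_
    rw [ContinuousLinearMap.adjoint_inner_left, inner_zero_left]
    exact (Submodule.mem_orthogonal' _ _).1 hf _ ⟨u, rfl⟩
  have h1 := huniq (fun τ => conj (∫ x : ℝ, conj (f x) * szegoKernel τ x))
    (fun τ hτ => differentiableAt_conj_inner_szegoLp f hτ) (by
      filter_upwards [adjoint_szegoOperator_coe h f, Lp.coeFn_zero ℂ 2 μ] with τ h1 h2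
      rw [← h1, hadj, h2, Pi.zero_apply])
  rw [inner_szegoLp]
  simpa using h1

end

/-! ### The curve: uniqueness set, kernel bound, and non-attainment. -/

namespace IsSimpleC1Curve

variable {γ : ℝ → ℂ}

theorem continuousOn_speed (hγ : IsSimpleC1Curve γ) :
    ContinuousOn (fun t => ‖derivWithin γ (Icc 0 1) t‖) (Icc 0 1) :=
  (hγ.contDiffOn.continuousOn_derivWithin (uniqueDiffOn_Icc zero_lt_one) le_rfl).norm

theorem aemeasurable_withDensity (hγ : IsSimpleC1Curve γ) (d : ℝ → ℝ≥0∞) :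
    AEMeasurable γ ((volume.restrict (Icc (0 : ℝ) 1)).withDensity d) :=
  (hγ.contDiffOn.continuousOn.aemeasurable measurableSet_Icc).mono_ac
    (withDensity_absolutelyContinuous _ _)

theorem isFiniteMeasure_arcLength (hγ : IsSimpleC1Curve γ) :
    IsFiniteMeasure (arcLength γ) := by
  have h1 : IntegrableOn (fun t => ‖derivWithin γ (Icc 0 1) t‖) (Icc 0 1) :=
    hγ.continuousOn_speed.integrableOn_compact isCompact_Icc
  have := isFiniteMeasure_withDensity_ofReal h1.2
  unfold arcLength
  infer_instance

theorem isCompact_curveTrace (hγ : IsSimpleC1Curve γ) : IsCompact (curveTrace γ) :=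
  isCompact_Icc.image_of_continuousOn hγ.contDiffOn.continuousOn

theorem ae_mem_curveTrace (hγ : IsSimpleC1Curve γ) :
    ∀ᵐ τ ∂(arcLength γ), τ ∈ curveTrace γ := by
  unfold arcLength
  refine (ae_map_iff (p := fun τ => τ ∈ curveTrace γ) (hγ.aemeasurable_withDensity _)
    hγ.isCompact_curveTrace.measurableSet).2 ?_
  refine (withDensity_absolutelyContinuous _ _).ae_le ?_
  filter_upwards [ae_restrict_mem measurableSet_Icc] with t ht
  exact mem_image_of_mem γ ht

/-- Nonvanishing speed makes arc-length null sets null in the parameter; continuity does the rest.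
-/
theorem eqOn_zero_of_ae_arcLength (hγ : IsSimpleC1Curve γ) {F : ℂ → ℂ}
    (hF : ContinuousOn F (curveTrace γ)) (h : ∀ᵐ τ ∂(arcLength γ), F τ = 0) :
    ∀ t ∈ Icc (0 : ℝ) 1, F (γ t) = 0 := by
  have h1 := ae_of_ae_map (hγ.aemeasurable_withDensity _) h
  have h2 : volume.restrict (Icc (0 : ℝ) 1) ≪ (volume.restrict (Icc (0 : ℝ) 1)).withDensity
      (fun t => ENNReal.ofReal ‖derivWithin γ (Icc 0 1) t‖) := by
    refine withDensity_absolutelyContinuous'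
      (hγ.continuousOn_speed.aemeasurable measurableSet_Icc).ennreal_ofReal ?_
    filter_upwards [ae_restrict_mem measurableSet_Icc] with t ht
    simpa using hγ.regular t ht
  have h3 : (fun t => F (γ t)) =ᵐ[volume.restrict (Icc (0 : ℝ) 1)] fun _ => 0 := h2.ae_le h1
  exact Measure.eqOn_Icc_of_ae_eq volume zero_ne_one h3
    (hF.comp hγ.contDiffOn.continuousOn (mapsTo_image _ _)) continuousOn_const

theorem apply_ne_apply_zero (hγ : IsSimpleC1Curve γ) {t : ℝ} (ht : t ∈ Ioo (0 : ℝ) 1) :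
    γ t ≠ γ 0 := fun h =>
  ht.2.ne (hγ.simple 0 (left_mem_Icc.2 zero_le_one) t (Ioo_subset_Icc_self ht) ht.1 h.symm).2

/-- By simplicity the zeros `γ t`, for `t ↓ 0`, accumulate at `γ 0` without reaching it, so the
identity theorem applies. -/
theorem eqOn_zero_upperHalfPlane (hγ : IsSimpleC1Curve γ)
    (hΓ : ∀ ζ ∈ curveTrace γ, 0 < ζ.im) {F : ℂ → ℂ}
    (hF : ∀ τ : ℂ, 0 < τ.im → DifferentiableAt ℂ F τ)
    (h : ∀ᵐ τ ∂(arcLength γ), F τ = 0) {z : ℂ} (hz : 0 < z.im) : F z = 0 := by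
  have h0 := hγ.eqOn_zero_of_ae_arcLength
    (fun τ hτ => (hF τ (hΓ τ hτ)).continuousAt.continuousWithinAt) h
  have hopen : IsOpen {ζ : ℂ | 0 < ζ.im} := isOpen_lt continuous_const Complex.continuous_im
  have han : AnalyticOnNhd ℂ F {ζ : ℂ | 0 < ζ.im} :=
    DifferentiableOn.analyticOnNhd (fun τ hτ => (hF τ hτ).differentiableWithinAt) hopen
  have hzero : (0 : ℝ) ∈ Icc (0 : ℝ) 1 := left_mem_Icc.2 zero_le_one
  refine han.eqOn_zero_of_preconnected_of_frequently_eq_zero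
    (convex_halfSpace_im_gt 0).isPreconnected (hΓ (γ 0) (mem_image_of_mem γ hzero)) ?_ hz
  have h1 : Tendsto γ (𝓝[Ioo 0 1] 0) (𝓝[≠] (γ 0)) := by
    refine tendsto_nhdsWithin_iff.2
      ⟨((hγ.contDiffOn.continuousOn 0 hzero).mono Ioo_subset_Icc_self).tendsto, ?_⟩
    filter_upwards [self_mem_nhdsWithin] with t ht using hγ.apply_ne_apply_zero ht
  have : (𝓝[Ioo (0 : ℝ) 1] 0).NeBot := by
    rw [nhdsWithin_Ioo_eq_nhdsGT zero_lt_one]; infer_instance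
  refine h1.frequently (Eventually.frequently ?_)
  filter_upwards [self_mem_nhdsWithin] with t ht using h0 t (Ioo_subset_Icc_self ht)

theorem exists_hasKernelBound (hγ : IsSimpleC1Curve γ)
    (hΓ : ∀ ζ ∈ curveTrace γ, 0 < ζ.im) : ∃ D, HasKernelBound (arcLength γ) D := by
  obtain ⟨R, hR⟩ := hγ.isCompact_curveTrace.isBounded.exists_norm_le
  have hne : (curveTrace γ).Nonempty := ⟨γ 0, mem_image_of_mem γ (left_mem_Icc.2 zero_le_one)⟩
  obtain ⟨σ, hσ, hmin⟩ := hγ.isCompact_curveTrace.exists_isMinOn hne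
    Complex.continuous_im.continuousOn
  have hR0 : 0 ≤ R := (norm_nonneg _).trans (hR σ hσ)
  have hσ' := hΓ σ hσ
  refine ⟨1 + (1 + R) / σ.im, by positivity, ?_⟩
  filter_upwards [hγ.ae_mem_curveTrace] with τ hτ
  exact ⟨hΓ τ hτ, one_add_abs_le_mul_norm hσ' (hR τ hτ) (hmin hτ)⟩

theorem not_isBounded_component (hγ : IsSimpleC1Curve γ) {z : ℂ} (hzΓ : z ∉ curveTrace γ)
    (hclosed : γ 0 = γ 1 → ¬ Bornology.IsBounded (connectedComponentIn (curveTrace γ)ᶜ z)) :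
    ¬ Bornology.IsBounded (connectedComponentIn (curveTrace γ)ᶜ z) := by
  by_cases hcl : γ 0 = γ 1
  · exact hclosed hcl
  have hrange : curveTrace γ = range fun t : Icc (0 : ℝ) 1 => γ t := by
    rw [curveTrace, image_eq_range]
  rw [hrange] at hzΓ ⊢
  refine not_isBounded_component_compl_arc
    (continuousOn_iff_continuous_domRestrict.1 hγ.contDiffOn.continuousOn) ?_ hzΓ
  have key : ∀ s t : Icc (0 : ℝ) 1, γ s = γ t → ¬ (s : ℝ) < t := by
    intro s t hst hlt
    obtain ⟨h0, h1⟩ := hγ.simple s s.2 t t.2 hlt hst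
    rw [h0, h1] at hst
    exact hcl hst
  intro s t hst
  exact Subtype.ext (le_antisymm (not_lt.1 (key t s hst.symm)) (not_lt.1 (key s t hst)))

theorem szegoLp_notMem_range (hγ : IsSimpleC1Curve γ) [IsFiniteMeasure (arcLength γ)] {D : ℝ}
    (h : HasKernelBound (arcLength γ) D) {z : ℂ} (hz : 0 < z.im) (hzΓ : z ∉ curveTrace γ)
    (hunb : ¬ Bornology.IsBounded (connectedComponentIn (curveTrace γ)ᶜ z)) :
    szegoLp hz ∉ range (szegoOperator h) := by
  rintro ⟨u, hu⟩
  have hui := integrable_of_Lp u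
  have hcont : Continuous fun x : ℝ => szegoKernel z x :=
    continuous_const.mul (continuous_const.div (by fun_prop) fun x =>
      sub_ofReal_ne_zero (by simpa using hz.ne') x)
  have heq : (fun x : ℝ => szegoIntegral (arcLength γ) u x) = fun x : ℝ => szegoKernel z x := by
    rw [← (h.continuous_ofReal hui).ae_eq_iff_eq volume hcont]
    exact (szegoOperator_coe h u).symm.trans (hu ▸ szegoLp_coe hz)
  set V := connectedComponentIn (curveTrace γ)ᶜ z
  have hVΓ : V ⊆ (curveTrace γ)ᶜ := connectedComponentIn_subset _ _
  have hclosedΓ : IsClosed (curveTrace γ) := hγ.isCompact_curveTrace.isClosed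
  have hVo : IsOpen V := hclosedΓ.isOpen_compl.connectedComponentIn
  -- The singularities of `𝒦u` lie on the conjugate of `Γ`, hence the reflected component.
  set U : Set ℂ := {ζ | conj ζ ∈ V} with hU
  have hUo : IsOpen U := hVo.preimage Complex.continuous_conj
  have hUp : IsPreconnected U := by
    have : U = conj '' V := by
      ext ζ
      refine ⟨fun hζ => ⟨conj ζ, hζ, Complex.conj_conj ζ⟩, ?_⟩
      rintro ⟨w, hw, rfl⟩
      simpa [hU] using hw
    rw [this]
    exact isPreconnected_connectedComponentIn.image _ Complex.continuous_conj.continuousOn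
  -- The factor `ζ - conj z` clears the pole of `p_z`: `Φ` vanishes on `ℝ` but equals `-i` at `conj
  -- z`.
  set Φ : ℂ → ℂ := fun ζ => (2 * (Real.pi : ℂ)) * (ζ - conj z) * szegoIntegral (arcLength γ) u ζ
    - Complex.I with hΦ
  have hΦd : DifferentiableOn ℂ Φ U := by
    intro ζ hζ
    have hdist : 0 < Metric.infDist (conj ζ) (curveTrace γ) :=
      (hclosedΓ.notMem_iff_infDist_pos
        ⟨γ 0, mem_image_of_mem γ (left_mem_Icc.2 zero_le_one)⟩).1 (hVΓ hζ)
    have h1 : DifferentiableAt ℂ (szegoIntegral (arcLength γ) u) ζ := by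
      refine differentiableAt_szegoIntegral hui hdist ?_
      filter_upwards [hγ.ae_mem_curveTrace] with τ hτ
      refine (Metric.infDist_le_dist_of_mem hτ).trans_eq ?_
      rw [dist_eq_norm, ← Complex.norm_conj]
      simp
    exact (((differentiableAt_id.sub_const (conj z)).const_mul _ |>.mul h1).sub_const
      Complex.I).differentiableWithinAt
  have hΦ0 : ∀ x : ℝ, Φ x = 0 := by
    intro x
    have h1 : szegoIntegral (arcLength γ) u x = szegoKernel z x := congr_fun heq x
    change 2 * (Real.pi : ℂ) * (x - conj z) * szegoIntegral (arcLength γ) u x - Complex.I = 0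
    rw [h1, szegoKernel]
    have := sub_ofReal_ne_zero (a := conj z) (by simpa using hz.ne') x
    have := Complex.ofReal_ne_zero.2 Real.pi_ne_zero
    field_simp
    ring
  obtain ⟨R, hRpos, hR⟩ := hγ.isCompact_curveTrace.isBounded.exists_pos_norm_le
  have hbig := compl_closedBall_subset_component hRpos
    (fun w hw => mem_closedBall_zero_iff.2 (hR w hw)) hunb
  -- Unboundedness enters here: it puts distant real points in the same component as `conj z`.
  have hx0 : ((R + 1 : ℝ) : ℂ) ∈ U := by
    refine hbig ?_
    rw [mem_compl_iff, mem_closedBall_zero_iff, Complex.norm_conj, Complex.norm_real,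
      Real.norm_of_nonneg (by positivity)]
    linarith
  have hzU : conj z ∈ U := by
    simpa [hU] using mem_connectedComponentIn hzΓ
  have hfin := (hΦd.analyticOnNhd hUo).eqOn_zero_of_preconnected_of_frequently_eq_zero hUp hx0 (by
    have h1 : Tendsto (fun x : ℝ => (x : ℂ)) (𝓝[≠] (R + 1)) (𝓝[≠] ((R + 1 : ℝ) : ℂ)) := by
      refine tendsto_nhdsWithin_iff.2
        ⟨(Complex.continuous_ofReal.tendsto _).mono_left nhdsWithin_le_nhds, ?_⟩
      filter_upwards [self_mem_nhdsWithin] with x hx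
      exact fun h => hx (Complex.ofReal_injective h)
    exact h1.frequently (Eventually.frequently (Eventually.of_forall hΦ0))) hzU
  simp [hΦ] at hfin

end IsSimpleC1Curve

/-! ### The extended solution, its boundary data, and the normal equation. -/

theorem pFun_eq_szegoKernel (z ζ : ℂ) : pFun z ζ = (2 * (Real.pi : ℂ)) * szegoKernel z ζ := by
  have := Complex.ofReal_ne_zero.2 Real.pi_ne_zero
  rw [pFun, szegoKernel]
  field_simp

section Extension

variable {γ : ℝ → ℂ} {D : ℝ} {z : ℂ}

theorem differentiableAt_extendSol (h : HasKernelBound (arcLength γ) D) (hz : 0 < z.im) (ε : ℝ)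
    {u : ℂ → ℂ} (hu : Integrable u (arcLength γ)) {ζ : ℂ} (hζ : 0 ≤ ζ.im) :
    DifferentiableAt ℂ (extendSol γ z ε u) ζ := by
  have hne : ζ - conj z ≠ 0 := by
    intro h0
    have := congr_arg Complex.im h0
    simp at this
    linarith
  refine DifferentiableAt.div_const (DifferentiableAt.sub ?_ (h.differentiableAt hu hζ)) _
  exact (differentiableAt_const _).div (differentiableAt_id.sub_const _) hne

theorem exists_norm_extendSol_le (h : HasKernelBound (arcLength γ) D) (hz : 0 < z.im) (ε : ℝ)
    {u : ℂ → ℂ} (hu : Integrable u (arcLength γ)) :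
    ∃ C : ℝ, 0 ≤ C ∧ ∀ ζ : ℂ, 0 ≤ ζ.im → ‖extendSol γ z ε u ζ‖ ≤ C * (1 + |ζ.re|)⁻¹ := by
  have hD := h.pos
  have hDz : 0 < 1 + (1 + ‖z‖) / z.im := by positivity
  have hI : 0 ≤ ∫ τ, ‖u τ‖ ∂(arcLength γ) := integral_nonneg fun _ => norm_nonneg _
  refine ⟨(1 + (1 + ‖z‖) / z.im + D * ∫ τ, ‖u τ‖ ∂(arcLength γ)) / ‖(ε : ℂ) ^ 2‖,
    by positivity, fun ζ hζ => ?_⟩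
  have h1 : ‖pFun z ζ‖ ≤ (1 + (1 + ‖z‖) / z.im) * (1 + |ζ.re|)⁻¹ := by
    rw [pFun, norm_div, Complex.norm_I, one_div]
    exact inv_norm_le_of_kernelBound (by positivity)
      (one_add_abs_le_mul_norm hz le_rfl le_rfl ζ hζ) hDz
  have h2 : ‖curveK γ u ζ‖ ≤ _ := h.norm_szegoIntegral_le hu hζ
  rw [extendSol, norm_div, div_mul_eq_mul_div, add_mul]
  gcongr
  exact (norm_sub_le _ _).trans (add_le_add h1 h2)

theorem memHardy2_extendSol (h : HasKernelBound (arcLength γ) D) (hz : 0 < z.im) (ε : ℝ)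
    {u : ℂ → ℂ} (hu : Integrable u (arcLength γ)) : MemHardy2 (extendSol γ z ε u) := by
  refine ⟨fun ζ hζ =>
    (differentiableAt_extendSol h hz ε hu (le_of_lt hζ)).differentiableWithinAt, ?_⟩
  obtain ⟨C, hC0, hC⟩ := exists_norm_extendSol_le h hz ε hu
  have hmem := memLp_inv_one_add_abs.const_mul C
  refine ⟨(eLpNorm (fun x : ℝ => C * (1 + |x|)⁻¹) 2 volume).toNNReal, fun y hy => ?_⟩
  rw [ENNReal.coe_toNNReal hmem.2.ne]
  refine eLpNorm_mono_real fun x => ?_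
  simpa using hC ((x : ℂ) + (y : ℂ) * Complex.I) (by simpa using hy.le)

theorem tendsto_extendSol (h : HasKernelBound (arcLength γ) D) (hz : 0 < z.im) (ε : ℝ)
    {u : ℂ → ℂ} (hu : Integrable u (arcLength γ)) (x : ℝ) :
    Tendsto (fun y : ℝ => extendSol γ z ε u ((x : ℂ) + (y : ℂ) * Complex.I)) (𝓝[>] 0)
      (𝓝 (extendSol γ z ε u x)) := by
  have h1 : Tendsto (fun y : ℝ => (x : ℂ) + (y : ℂ) * Complex.I) (𝓝[>] 0) (𝓝 (x : ℂ)) := by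
    have : Continuous fun y : ℝ => (x : ℂ) + (y : ℂ) * Complex.I := by fun_prop
    simpa using (this.tendsto 0).mono_left nhdsWithin_le_nhds
  exact (differentiableAt_extendSol h hz ε hu (ζ := (x : ℂ))
    (by simp)).continuousAt.tendsto.comp h1

theorem boundaryData_extendSol (h : HasKernelBound (arcLength γ) D) (hz : 0 < z.im) (ε : ℝ)
    {u : ℂ → ℂ} (hu : Integrable u (arcLength γ)) :
    boundaryData (extendSol γ z ε u) = fun x : ℝ => extendSol γ z ε u x :=
  funext fun x => (tendsto_extendSol h hz ε hu x).limUnder_eq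

theorem extendSol_ae_eq [IsFiniteMeasure (arcLength γ)] (h : HasKernelBound (arcLength γ) D)
    (hz : 0 < z.im) (ε : ℝ) (u : Lp ℂ 2 (arcLength γ)) :
    (((ε : ℂ) ^ 2)⁻¹ • ((2 * (Real.pi : ℂ)) • szegoLp hz - szegoOperator h u) :
      Lp ℂ 2 (volume : Measure ℝ)) =ᵐ[volume] boundaryData (extendSol γ z ε u) := by
  rw [boundaryData_extendSol h hz ε (integrable_of_Lp u)]
  filter_upwards [Lp.coeFn_smul ((ε : ℂ) ^ 2)⁻¹
      ((2 * (Real.pi : ℂ)) • szegoLp hz - szegoOperator h u),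
    Lp.coeFn_sub ((2 * (Real.pi : ℂ)) • szegoLp hz) (szegoOperator h u),
    Lp.coeFn_smul (2 * (Real.pi : ℂ)) (szegoLp hz), szegoLp_coe hz, szegoOperator_coe h u]
    with x h1 h2 h3 h4 h5
  rw [h1, Pi.smul_apply, h2, Pi.sub_apply, h3, Pi.smul_apply, h4, h5, smul_eq_mul, smul_eq_mul,
    ← pFun_eq_szegoKernel, inv_mul_eq_div]
  rfl

theorem SolvesEq.isTikhonov [IsFiniteMeasure (arcLength γ)] (h : HasKernelBound (arcLength γ) D)
    (hz : 0 < z.im) {ε : ℝ} {u : Lp ℂ 2 (arcLength γ)} (hu : SolvesEq γ z ε u) :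
    IsTikhonov (szegoOperator h) ((2 * (Real.pi : ℂ)) • szegoLp hz) ε u := by
  refine Lp.ext ?_
  rw [map_smul]
  filter_upwards [hu, adjoint_comp_szegoOperator_coe h u, adjoint_szegoOperator_szegoLp_coe h hz,
    Lp.coeFn_add ((szegoOperator h).adjoint (szegoOperator h u)) ((ε : ℂ) ^ 2 • u),
    Lp.coeFn_smul ((ε : ℂ) ^ 2) u,
    Lp.coeFn_smul (2 * (Real.pi : ℂ)) ((szegoOperator h).adjoint (szegoLp hz))]
    with τ h1 h2 h3 h4 h5 h6
  rw [h4, Pi.add_apply, h2, h5, Pi.smul_apply, h6, Pi.smul_apply, h3, smul_eq_mul, smul_eq_mul,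
    ← pFun_eq_szegoKernel, ← h1]
  rfl

end Extension

/-! ### Weak limits for functions, and the conclusion. -/

theorem weakTendstoL2_zero_of_inner {α : Type*} [MeasurableSpace α] {μ : Measure α}
    {ι : Type*} {l : Filter ι} {v : ι → α → ℂ} {w : ι → Lp ℂ 2 μ}
    (hvw : ∀ᶠ i in l, w i =ᵐ[μ] v i)
    (h : ∀ g : Lp ℂ 2 μ, Tendsto (fun i => inner ℂ g (w i)) l (𝓝 0)) :
    WeakTendstoL2 μ v l (fun _ => 0) := by
  refine ⟨?_, MemLp.zero', fun g hg => ?_⟩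
  · filter_upwards [hvw] with i hi using (memLp_congr_ae hi).1 (Lp.memLp _)
  · simp only [zero_mul, integral_zero]
    refine (h hg.toLp).congr' ?_
    filter_upwards [hvw] with i hi
    rw [L2.inner_def]
    refine integral_congr_ae ?_
    filter_upwards [hi, hg.coeFn_toLp] with x h1 h2
    rw [RCLike.inner_apply, h1, h2]

theorem lemma3p1 (γ : ℝ → ℂ) (hγ : IsSimpleC1Curve γ)
    (hΓ : ∀ ζ ∈ curveTrace γ, 0 < ζ.im)
    (z : ℂ) (hz : 0 < z.im) (hzΓ : z ∉ curveTrace γ)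
    (hclosed : γ 0 = γ 1 → ¬ Bornology.IsBounded (connectedComponentIn (curveTrace γ)ᶜ z))
    (u : ℝ → Lp ℂ 2 (arcLength γ)) (hu : ∀ ε : ℝ, 0 < ε → SolvesEq γ z ε (u ε)) :
    (∀ ε : ℝ, 0 < ε →
      MemHardy2 (extendSol γ z ε (u ε)) ∧
      HasBoundaryData (extendSol γ z ε (u ε)) (boundaryData (extendSol γ z ε (u ε)))) ∧
    Tendsto (fun ε : ℝ => ‖u ε‖) (𝓝[>] 0) atTop ∧
    WeakTendstoL2 (arcLength γ) (fun (ε : ℝ) (ζ : ℂ) => u ε ζ / (‖u ε‖ : ℂ))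
      (𝓝[>] 0) (fun _ => 0) ∧
    WeakTendstoL2 (volume : Measure ℝ)
      (fun (ε : ℝ) (x : ℝ) => boundaryData (extendSol γ z ε (u ε)) x /
        (hardyNorm (extendSol γ z ε (u ε)) : ℂ))
      (𝓝[>] 0) (fun _ => 0) ∧
    (fun ε : ℝ => ‖u ε‖) =o[𝓝[>] 0] (fun ε : ℝ => ε⁻¹) := by
  have := hγ.isFiniteMeasure_arcLength
  obtain ⟨D, h⟩ := hγ.exists_hasKernelBound hΓ
  set A := szegoOperator h
  set p := (2 * (Real.pi : ℂ)) • szegoLp hz with hpdef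
  have hpi : (2 * (Real.pi : ℂ)) ≠ 0 :=
    mul_ne_zero two_ne_zero (Complex.ofReal_ne_zero.2 Real.pi_ne_zero)
  have hT : ∀ ε, 0 < ε → IsTikhonov A p ε (u ε) := fun ε hε => (hu ε hε).isTikhonov h hz
  have hp : p ∈ closure (range A) := by
    have h1 := szegoLp_mem_closure_range h hz
      (fun F hF h0 => hγ.eqOn_zero_upperHalfPlane hΓ hF h0 hz)
    have hM : closure (range A) = (A.range.topologicalClosure : Set _) := by
      rw [Submodule.topologicalClosure_coe]; rfl
    rw [hM] at h1 ⊢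
    exact Submodule.smul_mem _ _ h1
  have hp' : p ∉ range A := by
    rintro ⟨v, hv⟩
    refine hγ.szegoLp_notMem_range h hz hzΓ (hγ.not_isBounded_component hzΓ hclosed)
      ⟨(2 * (Real.pi : ℂ))⁻¹ • v, ?_⟩
    change A _ = _
    rw [map_smul, hv, hpdef, smul_smul, inv_mul_cancel₀ hpi, one_smul]
  -- This holds for every `ε`: at `ε = 0` both sides are zero, by the convention for division by
  -- zero.
  have hbd : ∀ ε, _ := fun ε => extendSol_ae_eq h hz ε (u ε)
  refine ⟨fun ε _ => ⟨memHardy2_extendSol h hz ε (integrable_of_Lp _),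
    (memLp_congr_ae (hbd ε)).1 (Lp.memLp _), ?_⟩,
    tikhonov_norm_tendsto_atTop hT hp hp', ?_, ?_, tikhonov_isLittleO hT hp⟩
  · refine Eventually.of_forall fun x => ?_
    rw [boundaryData_extendSol h hz ε (integrable_of_Lp _)]
    exact tendsto_extendSol h hz ε (integrable_of_Lp _) x
  · refine weakTendstoL2_zero_of_inner (Eventually.of_forall fun ε => ?_)
      (tikhonov_weak hT hp hp')
    filter_upwards [Lp.coeFn_smul (‖u ε‖ : ℂ)⁻¹ (u ε)] with τ hτ
    rw [hτ, Pi.smul_apply, smul_eq_mul, inv_mul_eq_div]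
  · refine weakTendstoL2_zero_of_inner (Eventually.of_forall fun ε => ?_)
      (tikhonov_extension_weak hT hp hp' (U := fun ε => ((ε : ℂ) ^ 2)⁻¹ • (p - A (u ε)))
        fun _ _ => rfl)
    have hnorm : hardyNorm (extendSol γ z ε (u ε)) = ‖((ε : ℂ) ^ 2)⁻¹ • (p - A (u ε))‖ := by
      rw [hardyNorm, Lp.norm_def, eLpNorm_congr_ae (hbd ε)]
    filter_upwards [hbd ε, Lp.coeFn_smul (‖((ε : ℂ) ^ 2)⁻¹ • (p - A (u ε))‖ : ℂ)⁻¹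
      (((ε : ℂ) ^ 2)⁻¹ • (p - A (u ε)))] with x h1 h2
    rw [h2, Pi.smul_apply, h1, hnorm, smul_eq_mul, inv_mul_eq_div]
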